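/- Let $d\ge 0$ and let $(J_{x,y})_{x,y\in\mathbb Z^d}$ be real couplings with $J_{x,y}=J_{y,x}$ such that - (C1) $J_{x,y}=J_{0,y-x}$ for all $x,y$; - (C2) $J_{x,y}\ge 0$ for all $x,y$; - (C3) $\sum_{x\in\mathbb Z^d}J_{0,x}<\infty$; - (C4) for every $x\in\mathbb Z^d$ there are $m\ge 0$ and $0=x_0,x_1,\dots,x_m=x$ in $\mathbb Z^d$ with $\prod_{i=0}^{m-1}J_{x_i,x_{i+1}}>0$. Let $\beta\ge 0$. A current on a set $G$ is a function $\mathbf n$ from the unordered pairs of distinct elements of $G$ (the edges of $G$) to $\{0,1,2,\dots\}$, and its sources are the vertices $x$ for which $\sum_{y}\mathbf n_{x,y}$ is odd. For a finite set $G\subset\mathbb Z^d$, let $\mathrm P^0_{G,\beta}$ be the law of the random current on $G$ that gives to each current $\mathbf n$ without sources a probability proportional to $w_\beta(\mathbf n)=\prod_{\{x,y\}\subset G}(\beta J_{x,y})^{\mathbf n_{x,y}}/\mathbf n_{x,y}!$, and probability $0$ to every other current. Let $\mathrm P^+_{G,\beta}$ be the law obtained in the same way from currents on $G\cup\{\delta\}$,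 where $\delta\notin\mathbb Z^d$ is an additional vertex, which is never counted as a source, with $J_{x,\delta}=\sum_{y\in\mathbb Z^d\setminus G}J_{x,y}$ for $x\in G$, by restricting the current to the edges of $G$. Both are regarded as laws on currents on $\mathbb Z^d$, by setting the current to $0$ on all edges not contained in $G$. Let $\Lambda_L=[-L,L]^d\cap\mathbb Z^d$. Then for $\#\in\{0,+\}$ there is a probability measure $\mathrm P^\#_\beta$ on currents on $\mathbb Z^d$ such that $\lim_{L\to\infty}\mathrm P^\#_{\Lambda_L,\beta}[\mathcal A]=\mathrm P^\#_\beta[\mathcal A]$ for every event $\mathcal A$ depending on finitely many edges (such a measure is necessarily unique). Let $\mathbf n_1,\mathbf n_2$ be independent with laws $\mathrm P^0_\beta$ and $\mathrm P^+_\beta$, call an edge $\{x,y\}$ open if $(\mathbf n_1+\mathbf n_2)_{x,y}>0$, and let $\mathbb P_\beta$ be the law of the configuration of open and closed edges. Then, $\mathbb P_\beta$-almost surely, the graph on $\mathbb Z^d$ formed by the open edges has at most one infinite connected component. -/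

import Mathlib

open MeasureTheory Filter Topology
open scoped ENNReal Nat

noncomputable section

/-- Unordered pairs of distinct vertices of `V`. -/
abbrev Bond (V : Type*) := {e : Sym2 V // ¬ e.IsDiag}

/-- Currents on `V`: functions from bonds to `{0, 1, 2, …}` (with the product σ-algebra). -/
abbrev Current (V : Type*) := Bond V → ℕ

/-- The bonds with both endpoints in the finite set `G`. -/
def bondsIn {V : Type*} [DecidableEq V] (G : Finset V) : Finset (Bond V) :=
  G.sym2.subtype (fun e => ¬ e.IsDiag)

/-- Currents on the finite set `G`. -/
abbrev FinCurrent {V : Type*} [DecidableEq V] (G : Finset V) := bondsIn G → ℕ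

/-- A current on `G`, viewed as a current on `V` that vanishes on the bonds not contained in `G`. -/
def FinCurrent.extend {V : Type*} [DecidableEq V] {G : Finset V} (n : FinCurrent G) : Current V :=
  fun e => if h : e ∈ bondsIn G then n ⟨e, h⟩ else 0

/-- The total current `∑_y n_{x,y}` at the vertex `x`. -/
def FinCurrent.flux {V : Type*} [DecidableEq V] {G : Finset V} (n : FinCurrent G) (x : V) : ℕ :=
  ∑ e : bondsIn G with x ∈ e.1.1, n e

/-- The sources of `n` among the vertices of `S`. -/
def FinCurrent.sources {V : Type*} [DecidableEq V] {G : Finset V} (S : Finset V)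
    (n : FinCurrent G) : Finset V :=
  S.filter (fun x => Odd (n.flux x))

/-- The weight `w_β(n) = ∏_{x,y} (β K_{x,y})^{n_{x,y}} / n_{x,y}!`. -/
def FinCurrent.weight {V : Type*} [DecidableEq V] {G : Finset V} (β : ℝ) (K : Sym2 V → ℝ)
    (n : FinCurrent G) : ℝ :=
  ∏ e : bondsIn G, (β * K e.1.1) ^ n e / ((n e)! : ℝ)

/-- `w_β(n)` if `n` has no sources in `S`, and `0` otherwise. -/
def FinCurrent.sourcelessWeight {V : Type*} [DecidableEq V] {G : Finset V} (β : ℝ)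
    (K : Sym2 V → ℝ) (S : Finset V) (n : FinCurrent G) : ℝ≥0∞ :=
  if n.sources S = ∅ then ENNReal.ofReal (n.weight β K) else 0

/-- The law of the random current on `G` with couplings `K` and no sources in `S`: the current `n`
has probability `w_β(n) 1{∂n = ∅} / ∑_m w_β(m) 1{∂m = ∅}`. -/
def finiteCurrentLaw {V : Type*} [DecidableEq V] (β : ℝ) (K : Sym2 V → ℝ) (S G : Finset V) :
    Measure (Current V) :=
  Measure.sum fun n : FinCurrent G =>
    (n.sourcelessWeight β K S / ∑' m : FinCurrent G, m.sourcelessWeight β K S) •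
      Measure.dirac n.extend

/-- The couplings on `V ∪ {δ}`, the ghost vertex `δ` being `none`:
`J_{x,δ} = ∑_{y ∉ G} J_{x,y}`. -/
def ghostCoupling {V : Type*} [DecidableEq V] (J : Sym2 V → ℝ) (G : Finset V) :
    Sym2 (Option V) → ℝ :=
  Sym2.lift ⟨fun a b =>
    match a, b with
    | some x, some y => J s(x, y)
    | some x, none => ∑' y, if y ∈ G then 0 else J s(x, y)
    | none, some y => ∑' x, if x ∈ G then 0 else J s(y, x)
    | none, none => 0, by
      rintro (_ | x) (_ | y)
      · rfl
      · rfl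
      · rfl
      · exact congrArg J Sym2.eq_swap⟩

/-- A bond of `V` as a bond of `V ∪ {δ}`. -/
def Bond.toGhost {V : Type*} (e : Bond V) : Bond (Option V) :=
  ⟨e.1.map some, fun h => e.2 ((Sym2.isDiag_map (Option.some_injective V)).1 h)⟩

/-- The random current law on `G` with free boundary conditions. -/
def freeCurrentLaw {V : Type*} [DecidableEq V] (J : Sym2 V → ℝ) (β : ℝ) (G : Finset V) :
    Measure (Current V) :=
  finiteCurrentLaw β J G G

/-- The random current law on `G` with `+` boundary conditions: the law of a current on
`G ∪ {δ}` without sources in `G` (the ghost vertex is never listed as a source), restricted to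
the bonds that do not contain `δ`. -/
def plusCurrentLaw {V : Type*} [DecidableEq V] (J : Sym2 V → ℝ) (β : ℝ) (G : Finset V) :
    Measure (Current V) :=
  (finiteCurrentLaw β (ghostCoupling J G) (G.map Function.Embedding.some)
    (Finset.insertNone G)).map (fun n e => n e.toGhost)

/-- The box `Λ_L = [-L, L]^d`. -/
def latticeBox (d L : ℕ) : Finset (Fin d → ℤ) :=
  Finset.Icc (fun _ => -(L : ℤ)) (fun _ => (L : ℤ))

/-- `P` is a probability measure and `μ L A → P A` for every event `A` depending on finitely
many bonds. (Every subset of `E → ℕ`, with `E` finite, is measurable.) -/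
structure IsInfiniteVolumeLimit {V : Type*} (μ : ℕ → Measure (Current V))
    (P : Measure (Current V)) : Prop where
  isProbabilityMeasure : IsProbabilityMeasure P
  tendsto : ∀ (E : Finset (Bond V)) (A : Set (E → ℕ)),
    Tendsto (fun L => μ L (cylinder E A)) atTop (𝓝 (P (cylinder E A)))

/-- The percolation configuration `n̂` of a current: the bond `e` is open iff `n e > 0`. -/
def Current.trace {V : Type*} (n : Current V) : Bond V → Bool :=
  fun e => decide (0 < n e)

/-- The law of the trace of `n₁ + n₂`, for independent currents with laws `P₁` and `P₂`. -/
def sumTraceLaw {V : Type*} (P₁ P₂ : Measure (Current V)) : Measure (Bond V → Bool) :=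
  (P₁.prod P₂).map (fun p => Current.trace (p.1 + p.2))

/-- The graph of open bonds; its connected components are the clusters. -/
def openGraph {V : Type*} (ω : Bond V → Bool) : SimpleGraph V :=
  SimpleGraph.fromEdgeSet {e | ∃ h : ¬ e.IsDiag, ω ⟨e, h⟩ = true}

/-- Any two infinite clusters coincide. -/
def AtMostOneInfiniteCluster {V : Type*} (ω : Bond V → Bool) : Prop :=
  ∀ C C' : (openGraph ω).ConnectedComponent, C.supp.Infinite → C'.supp.Infinite → C = C'

end

/-!
The probability that a current agrees with `k` on a finite set `E` of bonds is a weight depending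
only on `k` times a ratio of Ising averages (expand `exp (K σ_x σ_y)` on the bonds outside `E` and
read off the sources as a product of spins). By Griffiths' inequalities these averages are monotone
in the volume, both for free and for `+` boundary conditions, so cylinder probabilities converge;
since a bond carries `m` with probability at most `K ^ m / m !`, the laws are tight and the limits
are probability measures. The averages converge along the net of all finite sets, which makes the
limits translation invariant.

Adding `2` to the current at a bond with positive coupling does not change the sources and changes
the weight by a positive factor, so the trace is insertion tolerant. A translation-invariant event
is almost surely unaffected by opening finitely many bonds, so two infinite clusters, which can be
joined in this way, force a third one; and three of them would produce furcations with positive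
density. As in Burton and Keane, the number of furcations in a box is at most the number of outside
vertices joined to the box by an open bond, which is of smaller order than the volume because the
couplings are summable.
-/

/-! ### Griffiths' second inequality on finite groups of spins -/

section Griffiths

/-- The inclusion of the signs into the real numbers; composing it with `χ : Ω →* ℤˣ` gives the
real characters of a group `Ω` of spin configurations. -/
noncomputable def signVal : ℤˣ →* ℝ :=
  (Int.castRingHom ℝ : ℤ →* ℝ).comp (Units.coeHom ℤ)

@[simp] lemma signVal_neg_one : signVal (-1) = -1 := by simp [signVal]

lemma abs_signVal (u : ℤˣ) : |signVal u| = 1 := by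
  rcases Int.units_eq_one_or u with rfl | rfl <;> simp

lemma signVal_le_one (u : ℤˣ) : signVal u ≤ 1 := (le_abs_self _).trans (abs_signVal u).le

/-- Nonnegative combinations of `±1`-valued characters. -/
inductive PositiveType {Ω : Type*} [Group Ω] : (Ω → ℝ) → Prop
  | char (c : ℝ) (hc : 0 ≤ c) (χ : Ω →* ℤˣ) : PositiveType fun σ => c * signVal (χ σ)
  | add {f g : Ω → ℝ} : PositiveType f → PositiveType g → PositiveType fun σ => f σ + g σ

namespace PositiveType

variable {Ω Ω' : Type*} [Group Ω] [Group Ω'] {f g : Ω → ℝ}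

lemma const {c : ℝ} (hc : 0 ≤ c) : PositiveType fun _ : Ω => c := by
  simpa using PositiveType.char c hc (1 : Ω →* ℤˣ)

lemma char_mul {c : ℝ} (hc : 0 ≤ c) (χ : Ω →* ℤˣ) (hf : PositiveType f) :
    PositiveType fun σ => c * signVal (χ σ) * f σ := by
  induction hf with
  | char c' hc' χ' =>
    convert PositiveType.char (c * c') (mul_nonneg hc hc') (χ * χ') using 2 with σ
    rw [MonoidHom.mul_apply, map_mul]
    ring
  | add _ _ h₁ h₂ =>
    convert h₁.add h₂ using 2
    ring

lemma mul (hf : PositiveType f) (hg : PositiveType g) : PositiveType fun σ => f σ * g σ := by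
  induction hf with
  | char c hc χ => exact char_mul hc χ hg
  | add _ _ h₁ h₂ =>
    convert h₁.add h₂ using 2
    ring

lemma prod {ι : Type*} (s : Finset ι) {f : ι → Ω → ℝ} (hf : ∀ i ∈ s, PositiveType (f i)) :
    PositiveType fun σ => ∏ i ∈ s, f i σ := by
  classical
  induction s using Finset.induction_on with
  | empty => simpa using const zero_le_one
  | insert a s ha ih =>
    simp only [Finset.prod_insert ha]
    exact (hf a (s.mem_insert_self a)).mul (ih fun i hi => hf i (Finset.mem_insert_of_mem hi))

lemma comp (hf : PositiveType f) (θ : Ω' →* Ω) : PositiveType fun σ => f (θ σ) := by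
  induction hf with
  | char c hc χ => exact PositiveType.char c hc (χ.comp θ)
  | add _ _ h₁ h₂ => exact h₁.add h₂

lemma sub_mul_right (hf : PositiveType f) (τ : Ω) :
    PositiveType fun σ => f σ - f (σ * τ) := by
  induction hf with
  | char c hc χ =>
    convert PositiveType.char (c * (1 - signVal (χ τ)))
      (mul_nonneg hc (sub_nonneg.2 (signVal_le_one _))) χ using 2 with σ
    simp only [map_mul]
    ring
  | add _ _ h₁ h₂ =>
    convert h₁.add h₂ using 2
    ring

lemma exp_char {c : ℝ} (hc : 0 ≤ c) (χ : Ω →* ℤˣ) :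
    PositiveType fun σ => Real.exp (c * signVal (χ σ)) := by
  have h : (fun σ => Real.exp (c * signVal (χ σ))) =
      fun σ => Real.cosh c + Real.sinh c * signVal (χ σ) := by
    ext σ
    rcases Int.units_eq_one_or (χ σ) with h | h
    · simp [h, Real.cosh_add_sinh]
    · simp [h, ← sub_eq_add_neg, Real.cosh_sub_sinh]
  rw [h]
  exact (const (Real.cosh_pos c).le).add (PositiveType.char _ (Real.sinh_nonneg_iff.2 hc) χ)

lemma one_add_char (χ : Ω →* ℤˣ) : PositiveType fun σ => 1 + signVal (χ σ) := by
  simpa using (const (Ω := Ω) zero_le_one).add (PositiveType.char 1 zero_le_one χ)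

lemma sum_nonneg [Fintype Ω] (hf : PositiveType f) : 0 ≤ ∑ σ, f σ := by
  classical
  induction hf with
  | char c hc χ =>
    have h := sum_hom_units (signVal.comp χ)
    simp only [MonoidHom.comp_apply] at h
    rw [← Finset.mul_sum, h]
    positivity
  | add _ _ h₁ h₂ =>
    rw [Finset.sum_add_distrib]
    exact add_nonneg h₁ h₂

end PositiveType

/-- Weights `w` for which every `σ ↦ w σ * w (σ τ)` is of positive type: this is what Ginibre's
duplication argument requires of a weight. -/
def GinibreWeight {Ω : Type*} [Group Ω] (w : Ω → ℝ) : Prop :=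
  ∀ τ, PositiveType fun σ => w σ * w (σ * τ)

namespace GinibreWeight

variable {Ω Ω' : Type*} [Group Ω] [Group Ω']

lemma exp_char {c : ℝ} (hc : 0 ≤ c) (χ : Ω →* ℤˣ) :
    GinibreWeight fun σ => Real.exp (c * signVal (χ σ)) := by
  intro τ
  rcases Int.units_eq_one_or (χ τ) with h | h
  · convert PositiveType.exp_char (by positivity : 0 ≤ 2 * c) χ using 2 with σ
    simp only [map_mul, h, mul_one, ← Real.exp_add]
    ring_nf
  · convert PositiveType.const (Ω := Ω) zero_le_one using 2 with σ
    simp only [map_mul, h, signVal_neg_one, ← Real.exp_add]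
    simp

lemma prod {ι : Type*} (s : Finset ι) {w : ι → Ω → ℝ} (hw : ∀ i ∈ s, GinibreWeight (w i)) :
    GinibreWeight fun σ => ∏ i ∈ s, w i σ := by
  intro τ
  simp only [← Finset.prod_mul_distrib]
  exact PositiveType.prod s fun i hi => hw i hi τ

lemma comp {w : Ω → ℝ} (hw : GinibreWeight w) (θ : Ω' →* Ω) :
    GinibreWeight fun σ => w (θ σ) := by
  intro τ
  simpa using (hw (θ τ)).comp θ

end GinibreWeight

lemma sum_sum_sub_mul_sub_mul {Ω R : Type*} [Fintype Ω] [CommRing R] (w f g : Ω → R) :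
    ∑ σ, ∑ τ, (f σ - f τ) * (g σ - g τ) * (w σ * w τ) =
      2 * ((∑ σ, f σ * g σ * w σ) * ∑ σ, w σ - (∑ σ, f σ * w σ) * ∑ σ, g σ * w σ) := by
  have h : ∑ σ, ∑ τ, (f σ - f τ) * (g σ - g τ) * (w σ * w τ) =
      ∑ σ, ∑ τ, (f σ * g σ * w σ * w τ + w σ * (f τ * g τ * w τ)
        - f σ * w σ * (g τ * w τ) - g σ * w σ * (f τ * w τ)) :=
    Finset.sum_congr rfl fun σ _ => Finset.sum_congr rfl fun τ _ => by ring
  simp only [h, Finset.sum_add_distrib, Finset.sum_sub_distrib, ← Finset.sum_mul_sum]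
  ring

theorem GinibreWeight.griffiths {Ω : Type*} [Group Ω] [Fintype Ω] {w f g : Ω → ℝ}
    (hw : GinibreWeight w) (hf : PositiveType f) (hg : PositiveType g) :
    (∑ σ, f σ * w σ) * ∑ σ, g σ * w σ ≤ (∑ σ, f σ * g σ * w σ) * ∑ σ, w σ := by
  have hpos : 0 ≤ ∑ τ, ∑ σ, (f σ - f (σ * τ)) * (g σ - g (σ * τ)) * (w σ * w (σ * τ)) :=
    Finset.sum_nonneg fun τ _ =>
      (((hf.sub_mul_right τ).mul (hg.sub_mul_right τ)).mul (hw τ)).sum_nonneg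
  have htranslate (σ : Ω) :
      ∑ τ, (f σ - f (σ * τ)) * (g σ - g (σ * τ)) * (w σ * w (σ * τ)) =
        ∑ τ, (f σ - f τ) * (g σ - g τ) * (w σ * w τ) :=
    Fintype.sum_equiv (Equiv.mulLeft σ) _ _ fun τ => rfl
  rw [Finset.sum_comm, Finset.sum_congr rfl fun σ _ => htranslate σ,
    sum_sum_sub_mul_sub_mul] at hpos
  linarith

end Griffiths

lemma hasSum_pi_prod {𝕜 ι κ : Type*} [RCLike 𝕜] [Fintype ι] [Countable κ] (f : ι → κ → 𝕜)
    (hf : ∀ i, Summable (f i)) :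
    HasSum (fun n : ι → κ => ∏ i, f i (n i)) (∏ i, ∑' k, f i k) := by
  let _ : MeasurableSpace κ := ⊤
  have hcount : (Measure.pi fun _ : ι => (Measure.count : Measure κ)) = Measure.count :=
    Measure.ext_of_singleton fun n => by
      rw [Measure.pi_singleton]
      simp
  have hint (i : ι) : Integrable (f i) Measure.count := integrable_count_iff.2 (hf i).norm
  have hprod := Integrable.fintype_prod hint
  have heq := integral_fintype_prod_eq_prod (μ := fun _ : ι => (Measure.count : Measure κ)) f
  rw [hcount] at hprod heq
  rw [integral_countable hprod] at heq
  simp only [integral_countable (hint _), measureReal_def, Measure.count_singleton,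
    ENNReal.toReal_one, one_smul] at heq
  exact heq ▸ (integrable_count_iff.1 hprod).of_norm.hasSum

/-! ### The spin representation of sourceless currents -/

section SpinRepresentation

/-- The product of the spins at the two endpoints of a pair, as a character of the group of spin
configurations. -/
def bondSpin {W : Type*} (e : Sym2 W) : (W → ℤˣ) →* ℤˣ where
  toFun σ := Sym2.lift ⟨fun x y => σ x * σ y, fun _ _ => mul_comm _ _⟩ e
  map_one' := by induction e; simp
  map_mul' σ τ := by induction e; simp [mul_mul_mul_comm]

@[simp] lemma bondSpin_mk {W : Type*} (x y : W) (σ : W → ℤˣ) :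
    bondSpin s(x, y) σ = σ x * σ y := rfl

/-- The product of the bond spins of `E`, with the multiplicities given by the current `k`. -/
def currentSpin {W : Type*} (E : Finset (Bond W)) (k : Current W) : (W → ℤˣ) →* ℤˣ :=
  ∏ e ∈ E, bondSpin e.1 ^ k e

lemma currentSpin_apply {W : Type*} (E : Finset (Bond W)) (k : Current W) (σ : W → ℤˣ) :
    currentSpin E k σ = ∏ e ∈ E, bondSpin e.1 σ ^ k e := by
  simp [currentSpin]

/-- The group of spin configurations on `S`, extended by `1` outside of `S`. -/
def spinsOn {W : Type*} (S : Finset W) : Subgroup (W → ℤˣ) where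
  carrier := {σ | ∀ x ∉ S, σ x = 1}
  mul_mem' hσ hτ x hx := by simp [hσ x hx, hτ x hx]
  one_mem' _ _ := rfl
  inv_mem' hσ x hx := by simp [hσ x hx]

instance {W : Type*} (S : Finset W) : Finite (spinsOn S) := by
  refine Finite.of_injective (β := S → ℤˣ) (fun σ x => σ.1 x) fun σ τ h => ?_
  ext x : 2
  by_cases hx : x ∈ S
  · exact congrFun h ⟨x, hx⟩
  · rw [σ.2 x hx, τ.2 x hx]

noncomputable instance {W : Type*} (S : Finset W) : Fintype (spinsOn S) := Fintype.ofFinite _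

/-- The Boltzmann weight `∏_{xy ∈ E} exp(K_{x,y} σ_x σ_y)` of an Ising spin configuration. -/
noncomputable def boltzmann {W : Type*} (K : Sym2 W → ℝ) (E : Finset (Bond W)) (σ : W → ℤˣ) : ℝ :=
  ∏ e ∈ E, Real.exp (K e.1 * signVal (bondSpin e.1 σ))

/-- The expectation of `f` when the spins in `S` are chosen with probability proportional
to `w`. -/
noncomputable def spinAverage {W : Type*} (S : Finset W) (w f : (W → ℤˣ) → ℝ) : ℝ :=
  (∑ σ : spinsOn S, f σ.1 * w σ.1) / ∑ σ : spinsOn S, w σ.1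

/-- The weight `∏_{xy ∈ E} K_{x,y} ^ k_{x,y} / k_{x,y}!` of the restriction of `k` to `E`. -/
noncomputable def currentWeight {W : Type*} (K : Sym2 W → ℝ) (E : Finset (Bond W))
    (k : Current W) : ℝ :=
  ∏ e ∈ E, K e.1 ^ k e / ((k e)! : ℝ)

/-- The currents that agree with `k` on `E`. -/
def pointCylinder {V : Type*} (E : Finset (Bond V)) (k : Current V) : Set (Current V) :=
  {n | ∀ e ∈ E, n e = k e}

@[simp] lemma pointCylinder_empty {V : Type*} (k : Current V) :
    pointCylinder ∅ k = Set.univ := by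
  ext n
  simp [pointCylinder]

lemma measurableSet_pointCylinder {V : Type*} (E : Finset (Bond V)) (k : Current V) :
    MeasurableSet (pointCylinder E k) := by
  have h : pointCylinder E k = ⋂ e ∈ E, (fun n : Current V => n e) ⁻¹' {k e} := by
    ext n
    simp [pointCylinder]
  rw [h]
  exact E.measurableSet_biInter fun e _ => measurable_pi_apply e (measurableSet_singleton _)

lemma boltzmann_pos {W : Type*} (K : Sym2 W → ℝ) (E : Finset (Bond W)) (σ : W → ℤˣ) :
    0 < boltzmann K E σ :=
  Finset.prod_pos fun _ _ => Real.exp_pos _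

lemma sum_spinsOn_pos {W : Type*} {S : Finset W} {w : (W → ℤˣ) → ℝ} (hw : ∀ σ, 0 < w σ) :
    0 < ∑ σ : spinsOn S, w σ.1 :=
  Finset.sum_pos (fun σ _ => hw σ.1) ⟨1, Finset.mem_univ _⟩

lemma tsum_pow_div_factorial_mul_pow (c s : ℝ) :
    ∑' m : ℕ, c ^ m / (m ! : ℝ) * s ^ m = Real.exp (c * s) := by
  rw [Real.exp_eq_exp_ℝ, NormedSpace.exp_eq_tsum_div]
  exact tsum_congr fun m => by rw [mul_pow, div_mul_eq_mul_div]

variable {W : Type*} [DecidableEq W]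

lemma boltzmann_mul_sdiff {K : Sym2 W → ℝ} {E E' : Finset (Bond W)} (h : E ⊆ E')
    (σ : W → ℤˣ) : boltzmann K E σ * boltzmann K (E' \ E) σ = boltzmann K E' σ := by
  rw [mul_comm]
  exact Finset.prod_sdiff h

lemma bondSpin_eq_prod {S : Finset W} {e : Sym2 W} (he : ¬ e.IsDiag) {σ : W → ℤˣ}
    (hσ : σ ∈ spinsOn S) : bondSpin e σ = ∏ x ∈ S with x ∈ e, σ x := by
  induction e with
  | h a b =>
  rw [Sym2.mk_isDiag_iff] at he
  have hsplit (x : W) : (if x ∈ s(a, b) then σ x else 1) =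
      (if x = a then σ x else 1) * (if x = b then σ x else 1) := by
    by_cases h₁ : x = a <;> by_cases h₂ : x = b <;> simp_all
  have hsingle (a : W) : (∏ x ∈ S, if x = a then σ x else 1) = σ a := by
    rw [Finset.prod_ite_eq' S a σ]
    split_ifs with ha
    · rfl
    · exact (hσ a ha).symm
  rw [Finset.prod_filter, Finset.prod_congr rfl fun x _ => hsplit x, Finset.prod_mul_distrib,
    hsingle, hsingle, bondSpin_mk]

variable {S G : Finset W}

lemma FinCurrent.extend_apply (n : FinCurrent G) (e : bondsIn G) : n.extend e.1 = n e :=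
  dif_pos e.2

lemma currentSpin_extend (n : FinCurrent G) {σ : W → ℤˣ} (hσ : σ ∈ spinsOn S) :
    currentSpin (bondsIn G) n.extend σ = ∏ x ∈ S, σ x ^ n.flux x := by
  rw [currentSpin_apply, ← Finset.prod_coe_sort]
  simp_rw [n.extend_apply, fun e : bondsIn G => bondSpin_eq_prod e.1.2 hσ, FinCurrent.flux,
    ← Finset.prod_pow_eq_pow_sum, Finset.prod_filter, ← Finset.prod_pow]
  rw [Finset.prod_comm]
  refine Finset.prod_congr rfl fun x _ => Finset.prod_congr rfl fun e _ => ?_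
  split_ifs <;> simp

lemma currentSpin_extend_eq_one_iff (n : FinCurrent G) :
    (∀ σ ∈ spinsOn S, currentSpin (bondsIn G) n.extend σ = 1) ↔ n.sources S = ∅ := by
  rw [FinCurrent.sources, Finset.filter_eq_empty_iff]
  constructor
  · intro h x hx hodd
    have hflip : Function.update (1 : W → ℤˣ) x (-1) ∈ spinsOn S := fun y hy =>
      Function.update_of_ne (ne_of_mem_of_not_mem hx hy).symm _ _
    have hone := h _ hflip
    rw [currentSpin_extend n hflip, Finset.prod_eq_single_of_mem x hx fun y _ hy => by
      simp [Function.update_of_ne hy], Function.update_self, hodd.neg_one_pow] at hone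
    exact absurd hone (by decide)
  · intro h σ hσ
    rw [currentSpin_extend n hσ]
    refine Finset.prod_eq_one fun x hx => ?_
    obtain ⟨k, hk⟩ := Nat.not_odd_iff_even.1 (h hx)
    rw [hk, ← two_mul, pow_mul, Int.units_sq, one_pow]

lemma sum_signVal_currentSpin_extend (n : FinCurrent G) :
    ∑ σ : spinsOn S, signVal (currentSpin (bondsIn G) n.extend σ.1) =
      if n.sources S = ∅ then (Fintype.card (spinsOn S) : ℝ) else 0 := by
  classical
  have hiff : signVal.comp ((currentSpin (bondsIn G) n.extend).comp (spinsOn S).subtype) = 1 ↔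
      n.sources S = ∅ := by
    rw [← currentSpin_extend_eq_one_iff, DFunLike.ext_iff]
    simp only [Subtype.forall, MonoidHom.comp_apply, MonoidHom.one_apply, Subgroup.subtype_apply]
    refine forall₂_congr fun σ _ => ⟨fun h => ?_, fun h => by rw [h, map_one]⟩
    refine (Int.units_eq_one_or _).resolve_right fun h' => ?_
    rw [h', signVal_neg_one] at h
    norm_num at h
  have h := sum_hom_units
    (signVal.comp ((currentSpin (bondsIn G) n.extend).comp (spinsOn S).subtype))
  simpa [hiff] using h

lemma hasSum_sourceless (S G : Finset W) (F : Bond W → ℕ → ℝ) (hF : ∀ e, Summable (F e)) :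
    HasSum (fun n : FinCurrent G =>
        if n.sources S = ∅ then ∏ e : bondsIn G, F e.1 (n e) else 0)
      ((∑ σ : spinsOn S, ∏ e ∈ bondsIn G, ∑' m, F e m * signVal (bondSpin e.1 σ.1) ^ m) /
        Fintype.card (spinsOn S)) := by
  have hσ (σ : spinsOn S) : HasSum
      (fun n : FinCurrent G => (∏ e : bondsIn G, F e.1 (n e)) *
        signVal (currentSpin (bondsIn G) n.extend σ.1))
      (∏ e ∈ bondsIn G, ∑' m, F e m * signVal (bondSpin e.1 σ.1) ^ m) := by
    rw [← Finset.prod_coe_sort]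
    simp only [currentSpin_apply, ← Finset.prod_coe_sort (bondsIn G), map_prod, map_pow,
      FinCurrent.extend_apply, ← Finset.prod_mul_distrib]
    exact hasSum_pi_prod (fun (e : bondsIn G) m => F e.1 m * signVal (bondSpin e.1.1 σ.1) ^ m)
      fun e => Summable.of_abs <| by simpa [abs_mul, abs_signVal] using (hF e.1).abs
  have hsum := (hasSum_sum fun σ (_ : σ ∈ Finset.univ) => hσ σ).div_const
    (Fintype.card (spinsOn S) : ℝ)
  simp only [← Finset.mul_sum, sum_signVal_currentSpin_extend, mul_ite, mul_zero, ite_div,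
    zero_div, mul_div_cancel_right₀ _ (Nat.cast_ne_zero (R := ℝ).2 Fintype.card_ne_zero)] at hsum
  exact hsum

variable {β : ℝ} {K : Sym2 W → ℝ} {E : Finset (Bond W)}

lemma sourcelessWeight_mul_indicator (hE : E ⊆ bondsIn G) (k : Current W) (n : FinCurrent G) :
    n.sourcelessWeight β K S * (pointCylinder E k).indicator 1 n.extend =
      ENNReal.ofReal (if n.sources S = ∅ then ∏ e : bondsIn G,
        if e.1 ∈ E ∧ n e ≠ k e.1 then 0 else (β * K e.1.1) ^ n e / ((n e)! : ℝ) else 0) := by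
  rw [FinCurrent.sourcelessWeight]
  by_cases hn : n.extend ∈ pointCylinder E k
  · have hagree (e : bondsIn G) : ¬ (e.1 ∈ E ∧ n e ≠ k e.1) := fun h =>
      h.2 (n.extend_apply e ▸ hn e.1 h.1)
    simp only [Set.indicator_of_mem hn, Pi.one_apply, mul_one, if_neg (hagree _)]
    split_ifs
    · rfl
    · exact ENNReal.ofReal_zero.symm
  · rw [Set.indicator_of_notMem hn, mul_zero]
    obtain ⟨e, he, hne⟩ : ∃ e ∈ E, n.extend e ≠ k e := by simpa [pointCylinder] using hn
    rw [n.extend_apply ⟨e, hE he⟩] at hne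
    refine (ENNReal.ofReal_eq_zero.2 ?_).symm
    split_ifs
    · exact le_of_eq (Finset.prod_eq_zero (Finset.mem_univ ⟨e, hE he⟩) (if_pos ⟨he, hne⟩))
    · exact le_rfl

lemma prod_tsum_eq_currentWeight_mul (hE : E ⊆ bondsIn G) (k : Current W) (σ : W → ℤˣ) :
    ∏ e ∈ bondsIn G, ∑' m, (if e ∈ E ∧ m ≠ k e then 0 else (β * K e.1) ^ m / (m ! : ℝ)) *
        signVal (bondSpin e.1 σ) ^ m =
      currentWeight (β • K) E k *
        (signVal (currentSpin E k σ) * boltzmann (β • K) (bondsIn G \ E) σ) := by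
  have hmem (e : Bond W) (he : e ∈ E) :
      ∑' m, (if e ∈ E ∧ m ≠ k e then 0 else (β * K e.1) ^ m / (m ! : ℝ)) *
          signVal (bondSpin e.1 σ) ^ m =
        (β • K) e.1 ^ k e / ((k e)! : ℝ) * signVal (bondSpin e.1 σ) ^ k e := by
    rw [tsum_eq_single (k e) fun m hm => by simp [he, hm]]
    simp
  have hnotMem (e : Bond W) (he : e ∈ bondsIn G \ E) :
      ∑' m, (if e ∈ E ∧ m ≠ k e then 0 else (β * K e.1) ^ m / (m ! : ℝ)) *
          signVal (bondSpin e.1 σ) ^ m =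
        Real.exp ((β • K) e.1 * signVal (bondSpin e.1 σ)) := by
    simp [(Finset.mem_sdiff.1 he).2, tsum_pow_div_factorial_mul_pow]
  rw [← Finset.prod_sdiff hE, Finset.prod_congr rfl hmem, Finset.prod_congr rfl hnotMem,
    Finset.prod_mul_distrib, currentSpin_apply, map_prod, currentWeight, boltzmann]
  simp only [map_pow]
  ring

lemma tsum_sourcelessWeight_mul_indicator (hK : ∀ e, 0 ≤ β * K e) (S : Finset W)
    (hE : E ⊆ bondsIn G) (k : Current W) :
    ∑' n : FinCurrent G,
        n.sourcelessWeight β K S * (pointCylinder E k).indicator 1 n.extend =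
      ENNReal.ofReal (currentWeight (β • K) E k *
        (∑ σ : spinsOn S,
          signVal (currentSpin E k σ.1) * boltzmann (β • K) (bondsIn G \ E) σ.1) /
        Fintype.card (spinsOn S)) := by
  have hexp (e : Bond W) (m : ℕ) : 0 ≤ (β * K e.1) ^ m / (m ! : ℝ) :=
    div_nonneg (pow_nonneg (hK _) _) (by positivity)
  have hnonneg (e : Bond W) (m : ℕ) :
      0 ≤ if e ∈ E ∧ m ≠ k e then 0 else (β * K e.1) ^ m / (m ! : ℝ) := by
    split_ifs
    exacts [le_rfl, hexp e m]
  have hsum := hasSum_sourceless S G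
    (fun e m => if e ∈ E ∧ m ≠ k e then 0 else (β * K e.1) ^ m / (m ! : ℝ)) fun e =>
      (Real.summable_pow_div_factorial (β * K e.1)).of_nonneg_of_le (hnonneg e) fun m => by
        split_ifs
        exacts [hexp e m, le_rfl]
  rw [tsum_congr (sourcelessWeight_mul_indicator hE k), ← ENNReal.ofReal_tsum_of_nonneg
    (fun n => ?_) hsum.summable, hsum.tsum_eq,
    Finset.sum_congr rfl fun σ _ => prod_tsum_eq_currentWeight_mul hE k σ.1, Finset.mul_sum]
  split_ifs
  exacts [Finset.prod_nonneg fun e _ => hnonneg e.1 (n e), le_rfl]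

lemma finiteCurrentLaw_pointCylinder (hK : ∀ e, 0 ≤ β * K e) (S : Finset W)
    (hE : E ⊆ bondsIn G) (k : Current W) :
    finiteCurrentLaw β K S G (pointCylinder E k) = ENNReal.ofReal (currentWeight (β • K) E k *
      spinAverage S (boltzmann (β • K) (bondsIn G \ E)) (fun σ => signVal (currentSpin E k σ)) /
      spinAverage S (boltzmann (β • K) (bondsIn G \ E)) (boltzmann (β • K) E)) := by
  have hpartition := tsum_sourcelessWeight_mul_indicator hK S (Finset.empty_subset (bondsIn G)) k
  simp only [pointCylinder_empty, Set.indicator_univ, Pi.one_apply, mul_one, currentWeight,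
    currentSpin, Finset.prod_empty, MonoidHom.one_apply, map_one, one_mul,
    Finset.sdiff_empty] at hpartition
  have hcard : (0 : ℝ) < Fintype.card (spinsOn S) := Nat.cast_pos.2 Fintype.card_pos
  have hZ := sum_spinsOn_pos (S := S) (boltzmann_pos (β • K) (bondsIn G))
  have hZ' := sum_spinsOn_pos (S := S) (boltzmann_pos (β • K) (bondsIn G \ E))
  rw [finiteCurrentLaw, Measure.sum_apply _ (measurableSet_pointCylinder E k)]
  simp only [Measure.smul_apply, smul_eq_mul,
    Measure.dirac_apply' _ (measurableSet_pointCylinder E k)]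
  simp only [← ENNReal.mul_div_right_comm]
  simp only [div_eq_mul_inv _ (tsum _)]
  rw [ENNReal.tsum_mul_right, tsum_sourcelessWeight_mul_indicator hK S hE k, hpartition,
    ← div_eq_mul_inv, ← ENNReal.ofReal_div_of_pos (div_pos hZ hcard)]
  simp only [spinAverage, boltzmann_mul_sdiff hE]
  congr 1
  field_simp

end SpinRepresentation

/-! ### Monotonicity of spin averages in the volume -/

section SpinAverage

variable {W : Type*} {S : Finset W} {w f g : (W → ℤˣ) → ℝ}

lemma spinAverage_const (hw : ∀ σ, 0 < w σ) (C : ℝ) : spinAverage S w (fun _ => C) = C := by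
  rw [spinAverage, ← Finset.mul_sum, mul_div_cancel_right₀ _ (sum_spinsOn_pos hw).ne']

lemma spinAverage_mono (hw : ∀ σ, 0 < w σ) (hfg : ∀ σ, f σ ≤ g σ) :
    spinAverage S w f ≤ spinAverage S w g :=
  div_le_div_of_nonneg_right (Finset.sum_le_sum fun σ _ =>
    mul_le_mul_of_nonneg_right (hfg σ.1) (hw σ.1).le) (sum_spinsOn_pos hw).le

lemma spinAverage_le (hw : ∀ σ, 0 < w σ) {C : ℝ} (hf : ∀ σ, f σ ≤ C) : spinAverage S w f ≤ C :=
  (spinAverage_mono hw hf).trans_eq (spinAverage_const hw C)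

lemma spinAverage_nonneg (hw : ∀ σ, 0 < w σ) (hw' : PositiveType w) (hf : PositiveType f) :
    0 ≤ spinAverage S w f :=
  div_nonneg ((hf.mul hw').comp (spinsOn S).subtype).sum_nonneg (sum_spinsOn_pos hw).le

lemma spinAverage_eq_of_eq_mul {w' : (W → ℤˣ) → ℝ} {c : ℝ} (hc : c ≠ 0)
    (h : ∀ σ ∈ spinsOn S, w' σ = c * w σ) : spinAverage S w' f = spinAverage S w f := by
  have hS (σ : spinsOn S) : w' σ.1 = c * w σ.1 := h σ.1 σ.2
  simp only [spinAverage, hS, mul_left_comm _ c, ← Finset.mul_sum]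
  exact mul_div_mul_left _ _ hc

lemma spinAverage_le_spinAverage_mul (hw : ∀ σ, 0 < w σ) (hw' : GinibreWeight w)
    (hf : PositiveType f) (hg : PositiveType g) (hgw : 0 < ∑ σ : spinsOn S, g σ.1 * w σ.1) :
    spinAverage S w f ≤ spinAverage S (fun σ => g σ * w σ) f := by
  have h := (hw'.comp (spinsOn S).subtype).griffiths (hf.comp (spinsOn S).subtype)
    (hg.comp (spinsOn S).subtype)
  rw [spinAverage, spinAverage, div_le_div_iff₀ (sum_spinsOn_pos hw) hgw]
  simpa [mul_assoc] using h

lemma positiveType_currentSpin (E : Finset (Bond W)) (k : Current W) :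
    PositiveType fun σ => signVal (currentSpin E k σ) := by
  simpa using PositiveType.char 1 zero_le_one (currentSpin E k)

lemma positiveType_boltzmann {K : Sym2 W → ℝ} (hK : ∀ e, 0 ≤ K e) (E : Finset (Bond W)) :
    PositiveType (boltzmann K E) :=
  PositiveType.prod _ fun _ _ => PositiveType.exp_char (hK _) _

lemma ginibreWeight_boltzmann {K : Sym2 W → ℝ} (hK : ∀ e, 0 ≤ K e) (E : Finset (Bond W)) :
    GinibreWeight (boltzmann K E) :=
  GinibreWeight.prod _ fun _ _ => GinibreWeight.exp_char (hK _) _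

lemma boltzmann_le {K : Sym2 W → ℝ} (hK : ∀ e, 0 ≤ K e) (E : Finset (Bond W)) (σ : W → ℤˣ) :
    boltzmann K E σ ≤ ∏ e ∈ E, Real.exp (K e.1) :=
  Finset.prod_le_prod (fun _ _ => (Real.exp_pos _).le) fun _ _ =>
    Real.exp_le_exp.2 (mul_le_of_le_one_right (hK _) (signVal_le_one _))

lemma spinAverage_boltzmann_mono {K : Sym2 W → ℝ} (hK : ∀ e, 0 ≤ K e)
    {E E' : Finset (Bond W)} (hE : E ⊆ E') (hf : PositiveType f) :
    spinAverage S (boltzmann K E) f ≤ spinAverage S (boltzmann K E') f := by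
  classical
  have hsplit : boltzmann K E' = fun σ => boltzmann K (E' \ E) σ * boltzmann K E σ :=
    funext fun σ => by rw [mul_comm, boltzmann_mul_sdiff hE]
  rw [hsplit]
  refine spinAverage_le_spinAverage_mul (boltzmann_pos K E) (ginibreWeight_boltzmann hK E) hf
    (positiveType_boltzmann hK (E' \ E)) ?_
  exact sum_spinsOn_pos (w := fun σ => boltzmann K (E' \ E) σ * boltzmann K E σ) fun σ =>
    mul_pos (boltzmann_pos _ _ _) (boltzmann_pos _ _ _)

end SpinAverage

section BondsIn

variable {W : Type*} [DecidableEq W]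

lemma mem_bondsIn {G : Finset W} {e : Bond W} : e ∈ bondsIn G ↔ ∀ x ∈ e.1, x ∈ G := by
  simp [bondsIn, Finset.mem_sym2_iff]

lemma bondsIn_mono {G G' : Finset W} (h : G ⊆ G') : bondsIn G ⊆ bondsIn G' := fun _ he =>
  mem_bondsIn.2 fun x hx => h (mem_bondsIn.1 he x hx)

lemma exists_bondsIn_superset (E : Finset (Bond W)) : ∃ G : Finset W, E ⊆ bondsIn G := by
  refine ⟨E.biUnion fun e => e.1.toFinset, fun e he => mem_bondsIn.2 fun x hx => ?_⟩
  exact Finset.mem_biUnion.2 ⟨e, he, Sym2.mem_toFinset.2 hx⟩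

lemma prod_bondsIn_insert {M : Type*} [CommMonoid M] {z : W} {G : Finset W} (hz : z ∉ G)
    (g : Sym2 W → M) :
    ∏ e ∈ bondsIn (insert z G), g e.1 = (∏ x ∈ G, g s(z, x)) * ∏ e ∈ bondsIn G, g e.1 := by
  have hfilter (G : Finset W) : ∏ e ∈ bondsIn G, g e.1 = ∏ e ∈ G.sym2 with ¬ e.IsDiag, g e :=
    Finset.prod_subtype_eq_prod_filter g
  have hstar : ((insert z G).image fun x => s(z, x)).filter (fun e => ¬ e.IsDiag) =
      G.image fun x => s(z, x) := by
    ext e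
    simp only [Finset.mem_filter, Finset.mem_image, Finset.mem_insert, exists_eq_or_imp]
    constructor
    · rintro ⟨rfl | h, hdiag⟩
      exacts [absurd rfl hdiag, h]
    · rintro ⟨x, hx, rfl⟩
      exact ⟨Or.inr ⟨x, hx, rfl⟩, (ne_of_mem_of_not_mem hx hz).symm⟩
  rw [hfilter, hfilter, Finset.sym2_insert, Finset.filter_union, hstar, Finset.prod_union,
    Finset.prod_image fun x _ y _ => Sym2.congr_right.1]
  rw [Finset.disjoint_left]
  intro e he he'
  obtain ⟨x, -, rfl⟩ := Finset.mem_image.1 he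
  exact hz (Finset.mk_mem_sym2_iff.1 (Finset.mem_filter.1 he').1).1

end BondsIn

section FreeBoundary

variable {W : Type*} [DecidableEq W]

/-- The homomorphism resetting the spins outside of `S` to `1`. -/
def truncateSpins (S : Finset W) : (W → ℤˣ) →* (W → ℤˣ) where
  toFun σ x := if x ∈ S then σ x else 1
  map_one' := by
    ext
    simp
  map_mul' σ τ := by
    ext x
    by_cases h : x ∈ S <;> simp [h]

lemma truncateSpins_mem (S : Finset W) (σ : W → ℤˣ) : truncateSpins S σ ∈ spinsOn S :=
  fun x hx => by simp [truncateSpins, hx]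

lemma truncateSpins_of_mem {S : Finset W} {σ : W → ℤˣ} (hσ : σ ∈ spinsOn S) :
    truncateSpins S σ = σ := by
  ext x : 1
  by_cases hx : x ∈ S
  · simp [truncateSpins, hx]
  · simp [truncateSpins, hx, hσ x hx]

lemma bondSpin_truncateSpins {S : Finset W} {e : Bond W} (he : e ∈ bondsIn S) (σ : W → ℤˣ) :
    bondSpin e.1 (truncateSpins S σ) = bondSpin e.1 σ := by
  obtain ⟨e, h⟩ := e
  rw [mem_bondsIn] at he
  induction e with
  | h a b =>
  have ha : a ∈ S := he a (by simp)
  have hb : b ∈ S := he b (by simp)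
  simp [truncateSpins, ha, hb]

lemma currentSpin_truncateSpins {S : Finset W} {E : Finset (Bond W)} (hE : E ⊆ bondsIn S)
    (k : Current W) (σ : W → ℤˣ) : currentSpin E k (truncateSpins S σ) = currentSpin E k σ := by
  rw [currentSpin_apply, currentSpin_apply]
  exact Finset.prod_congr rfl fun e he => by rw [bondSpin_truncateSpins (hE he)]

lemma boltzmann_truncateSpins {S : Finset W} {E : Finset (Bond W)} (hE : E ⊆ bondsIn S)
    (K : Sym2 W → ℝ) (σ : W → ℤˣ) : boltzmann K E (truncateSpins S σ) = boltzmann K E σ :=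
  Finset.prod_congr rfl fun e he => by rw [bondSpin_truncateSpins (hE he)]

lemma exists_sum_comp_eq_mul_sum {Ω Ω' : Type*} [Group Ω] [Group Ω'] [Fintype Ω] [Fintype Ω']
    (θ : Ω' →* Ω) (hθ : Function.Surjective θ) :
    ∃ c : ℝ, 0 < c ∧ ∀ g : Ω → ℝ, ∑ σ, g (θ σ) = c * ∑ σ, g σ := by
  classical
  refine ⟨((Finset.univ.filter fun σ => θ σ = 1).card : ℝ), ?_, fun g => ?_⟩
  · exact_mod_cast Finset.card_pos.2 ⟨1, by simp⟩
  · rw [← Finset.sum_fiberwise Finset.univ θ, Finset.mul_sum]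
    refine Finset.sum_congr rfl fun σ _ => ?_
    rw [Finset.sum_congr rfl (g := fun _ => g σ) (by simp +contextual), Finset.sum_const,
      nsmul_eq_mul, MonoidHom.card_fiber_eq_of_mem_range θ (hθ σ) (hθ 1)]

lemma spinAverage_of_subset {S T : Finset W} (h : S ⊆ T) {w f : (W → ℤˣ) → ℝ}
    (hw : ∀ σ, w (truncateSpins S σ) = w σ) (hf : ∀ σ, f (truncateSpins S σ) = f σ) :
    spinAverage T w f = spinAverage S w f := by
  let θ : spinsOn T →* spinsOn S :=
    ((truncateSpins S).comp (spinsOn T).subtype).codRestrict (spinsOn S)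
      fun σ => truncateSpins_mem S σ.1
  have hθ : Function.Surjective θ := fun σ =>
    ⟨⟨σ.1, fun x hx => σ.2 x fun hx' => hx (h hx')⟩, Subtype.ext (truncateSpins_of_mem σ.2)⟩
  obtain ⟨c, hc, hsum⟩ := exists_sum_comp_eq_mul_sum θ hθ
  have hnum := hsum fun σ => f σ.1 * w σ.1
  have hden := hsum fun σ => w σ.1
  have hcoe (σ : spinsOn T) : (θ σ).1 = truncateSpins S σ.1 := rfl
  simp only [hcoe, hw, hf] at hnum hden
  rw [spinAverage, spinAverage, hnum, hden, mul_div_mul_left _ _ hc.ne']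

variable {K : Sym2 W → ℝ} {f : (W → ℤˣ) → ℝ}

lemma spinAverage_free_mono (hK : ∀ e, 0 ≤ K e) {G G' : Finset W} (h : G ⊆ G')
    (E : Finset (Bond W)) (hf : PositiveType f) (hloc : ∀ σ, f (truncateSpins G σ) = f σ) :
    spinAverage G (boltzmann K (bondsIn G \ E)) f ≤
      spinAverage G' (boltzmann K (bondsIn G' \ E)) f := by
  rw [← spinAverage_of_subset h (boltzmann_truncateSpins Finset.sdiff_subset K) hloc]
  exact spinAverage_boltzmann_mono hK (Finset.sdiff_subset_sdiff (bondsIn_mono h) subset_rfl) hf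

lemma exists_tendsto_spinAverage_free (hK : ∀ e, 0 ≤ K e) {G₀ : Finset W} (E : Finset (Bond W))
    (hf : PositiveType f) (hloc : ∀ G, G₀ ⊆ G → ∀ σ, f (truncateSpins G σ) = f σ)
    {C : ℝ} (hC : ∀ σ, f σ ≤ C) :
    ∃ l, Tendsto (fun G => spinAverage G (boltzmann K (bondsIn G \ E)) f) atTop (𝓝 l) := by
  have hmono : Monotone fun G : Finset W =>
      spinAverage (G₀ ∪ G) (boltzmann K (bondsIn (G₀ ∪ G) \ E)) f := fun G G' h =>
    spinAverage_free_mono hK (Finset.union_subset_union_right h) E hf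
      (hloc _ Finset.subset_union_left)
  have hbdd : BddAbove (Set.range fun G : Finset W =>
      spinAverage (G₀ ∪ G) (boltzmann K (bondsIn (G₀ ∪ G) \ E)) f) := by
    refine ⟨C, ?_⟩
    rintro _ ⟨G, rfl⟩
    exact spinAverage_le (boltzmann_pos _ _) hC
  refine ⟨_, (tendsto_atTop_ciSup hmono hbdd).congr' ?_⟩
  filter_upwards [eventually_ge_atTop G₀] with G hG
  rw [Finset.union_eq_right.2 hG]

end FreeBoundary

section PlusBoundary

variable {V : Type*}

lemma toGhost_injective : Function.Injective (Bond.toGhost (V := V)) := fun _ _ h =>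
  Subtype.ext (Sym2.map.injective (Option.some_injective V) (congrArg Subtype.val h))

/-- The bonds of `E`, as bonds of the graph with the ghost vertex. -/
def ghostBonds (E : Finset (Bond V)) : Finset (Bond (Option V)) :=
  E.map ⟨Bond.toGhost, toGhost_injective⟩

variable [DecidableEq V]

@[simp] lemma ghostCoupling_some_some (J : Sym2 V → ℝ) (G : Finset V) (x y : V) :
    ghostCoupling J G s(some x, some y) = J s(x, y) := rfl

@[simp] lemma ghostCoupling_none_some (J : Sym2 V → ℝ) (G : Finset V) (x : V) :
    ghostCoupling J G s(none, some x) = ∑' y, if y ∈ G then 0 else J s(x, y) := rfl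

@[simp] lemma ghostCoupling_toGhost (J : Sym2 V → ℝ) (G : Finset V) (e : Bond V) :
    ghostCoupling J G e.toGhost.1 = J e.1 := by
  obtain ⟨e, he⟩ := e
  induction e with
  | h a b => rfl

lemma ghostCoupling_nonneg {J : Sym2 V → ℝ} (hJ : ∀ e, 0 ≤ J e) (G : Finset V)
    (e : Sym2 (Option V)) : 0 ≤ ghostCoupling J G e := by
  have hghost (x : V) : 0 ≤ ∑' y, if y ∈ G then 0 else J s(x, y) :=
    tsum_nonneg fun y => by
      split_ifs
      exacts [le_rfl, hJ _]
  induction e with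
  | h a b =>
    rcases a with _ | a <;> rcases b with _ | b
    exacts [le_rfl, hghost b, hghost a, hJ _]

lemma smul_ghostCoupling (β : ℝ) (J : Sym2 V → ℝ) (G : Finset V) :
    β • ghostCoupling J G = ghostCoupling (β • J) G := by
  have hghost (x : V) : β * ghostCoupling J G s(none, some x) =
      ghostCoupling (β • J) G s(none, some x) := by
    simp only [ghostCoupling_none_some, ← tsum_mul_left, Pi.smul_apply, smul_eq_mul, mul_ite,
      mul_zero]
  ext e
  induction e with
  | h a b =>
    rcases a with _ | a <;> rcases b with _ | b
    exacts [mul_zero β, hghost b, hghost a, rfl]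

lemma boltzmann_ghostBonds (J : Sym2 V → ℝ) (G G' : Finset V) (E : Finset (Bond V)) :
    boltzmann (ghostCoupling J G) (ghostBonds E) =
      boltzmann (ghostCoupling J G') (ghostBonds E) := by
  ext σ
  simp [boltzmann, ghostBonds]

lemma ghostBonds_subset {E : Finset (Bond V)} {G : Finset V} (hE : E ⊆ bondsIn G) :
    ghostBonds E ⊆ bondsIn (Finset.insertNone G) := by
  intro e he
  obtain ⟨e, he', rfl⟩ := Finset.mem_map.1 he
  refine mem_bondsIn.2 fun x hx => ?_
  obtain ⟨y, hy, rfl⟩ := Sym2.mem_map.1 hx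
  simpa using mem_bondsIn.1 (hE he') y hy

lemma tsum_ite_mem_eq_add_tsum_ite_mem_insert {f : V → ℝ} (hf : Summable f) {z : V}
    {G : Finset V} (hz : z ∉ G) :
    (∑' y, if y ∈ G then 0 else f y) = f z + ∑' y, if y ∈ insert z G then 0 else f y := by
  have hsum : Summable fun y => if y ∈ G then 0 else f y :=
    (hf.indicator (G : Set V)ᶜ).congr fun y => by by_cases hy : y ∈ G <;> simp [hy]
  rw [hsum.tsum_eq_add_tsum_ite z, if_neg hz]
  congr 1
  refine tsum_congr fun y => ?_
  by_cases hy : y = z <;> simp [hy]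

lemma boltzmann_ghostCoupling_map_some (J : Sym2 V → ℝ) (G G' T : Finset V)
    (σ : Option V → ℤˣ) :
    boltzmann (ghostCoupling J G) (bondsIn (T.map .some)) σ =
      boltzmann (ghostCoupling J G') (bondsIn (T.map .some)) σ := by
  refine Finset.prod_congr rfl fun e he => ?_
  obtain ⟨e, he'⟩ := e
  rw [mem_bondsIn] at he
  induction e with
  | h a b =>
  obtain ⟨x, -, rfl⟩ := Finset.mem_map.1 (he a (by simp))
  obtain ⟨y, -, rfl⟩ := Finset.mem_map.1 (he b (by simp))
  rfl

lemma boltzmann_bondsIn_insert {W : Type*} [DecidableEq W] (K : Sym2 W → ℝ) {z : W}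
    {G : Finset W} (hz : z ∉ G) (σ : W → ℤˣ) :
    boltzmann K (bondsIn (insert z G)) σ =
      (∏ x ∈ G, Real.exp (K s(z, x) * signVal (σ z * σ x))) * boltzmann K (bondsIn G) σ :=
  prod_bondsIn_insert hz fun e => Real.exp (K e * signVal (bondSpin e σ))

variable {J : Sym2 V → ℝ} {z : V} {G : Finset V}

/-- A spin frozen to `1` at `z` is merged with the ghost vertex. -/
lemma boltzmann_ghostCoupling_insert (hJ : ∀ x, Summable fun y => J s(x, y)) (hz : z ∉ G)
    {σ : Option V → ℤˣ} (hσz : σ (some z) = 1) (hσ : σ none = 1) :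
    boltzmann (ghostCoupling J (insert z G)) (bondsIn (Finset.insertNone (insert z G))) σ =
      Real.exp (ghostCoupling J (insert z G) s(none, some z)) *
        boltzmann (ghostCoupling J G) (bondsIn (Finset.insertNone G)) σ := by
  have hinsert (T : Finset V) : Finset.insertNone T = insert none (T.map .some) := by
    ext (_ | x) <;> simp
  have hnone (T : Finset V) : none ∉ T.map Function.Embedding.some := by simp
  have hz' : some z ∉ G.map .some := by simpa using hz
  rw [hinsert, hinsert, boltzmann_bondsIn_insert _ (hnone _), boltzmann_bondsIn_insert _ (hnone _),
    Finset.map_insert, Function.Embedding.some_apply, boltzmann_bondsIn_insert _ hz',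
    boltzmann_ghostCoupling_map_some J (insert z G) G, Finset.prod_insert hz']
  simp only [Finset.prod_map, Function.Embedding.some_apply, hσ, hσz, one_mul, map_one, mul_one,
    ghostCoupling_some_some, ghostCoupling_none_some,
    tsum_ite_mem_eq_add_tsum_ite_mem_insert (hJ _) hz, add_mul, Real.exp_add,
    Finset.prod_mul_distrib, Sym2.eq_swap (a := z)]
  ring

lemma boltzmann_ghostCoupling_insert_sdiff (hJ : ∀ x, Summable fun y => J s(x, y)) (hz : z ∉ G)
    {E : Finset (Bond V)} (hE : E ⊆ bondsIn G) {σ : Option V → ℤˣ} (hσz : σ (some z) = 1)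
    (hσ : σ none = 1) :
    boltzmann (ghostCoupling J (insert z G))
        (bondsIn (Finset.insertNone (insert z G)) \ ghostBonds E) σ =
      Real.exp (ghostCoupling J (insert z G) s(none, some z)) *
        boltzmann (ghostCoupling J G) (bondsIn (Finset.insertNone G) \ ghostBonds E) σ := by
  refine mul_left_cancel₀ (boltzmann_pos (ghostCoupling J G) (ghostBonds E) σ).ne' ?_
  rw [mul_left_comm, boltzmann_mul_sdiff (ghostBonds_subset hE),
    boltzmann_ghostBonds J G (insert z G), boltzmann_mul_sdiff (ghostBonds_subset
      (hE.trans (bondsIn_mono (Finset.subset_insert z G)))),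
    boltzmann_ghostCoupling_insert hJ hz hσz hσ]

lemma sum_one_add_spin_mul {W : Type*} [DecidableEq W] {S : Finset W} {z : W} (hz : z ∉ S)
    (g : (W → ℤˣ) → ℝ) :
    ∑ σ : spinsOn (insert z S), (1 + signVal (σ.1 z)) * g σ.1 = 2 * ∑ σ : spinsOn S, g σ.1 := by
  have hS : spinsOn S ≤ spinsOn (insert z S) := fun σ hσ x hx =>
    hσ x fun h => hx (Finset.mem_insert_of_mem h)
  rw [Finset.mul_sum]
  refine (Fintype.sum_of_injective (Subgroup.inclusion hS) (Subgroup.inclusion_injective hS)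
    _ _ ?_ ?_).symm
  · intro σ hσ
    rcases Int.units_eq_one_or (σ.1 z) with h | h
    · refine absurd ⟨⟨σ.1, fun x hx => ?_⟩, rfl⟩ hσ
      by_cases hxz : x = z
      · rw [hxz, h]
      · exact σ.2 x (by simp [hxz, hx])
    · simp [h]
  · intro σ
    simp only [Subgroup.coe_inclusion, σ.2 z hz, map_one]
    norm_num

lemma spinAverage_insert_one_add_spin {W : Type*} [DecidableEq W] {S : Finset W} {z : W}
    (hz : z ∉ S) (w f : (W → ℤˣ) → ℝ) :
    spinAverage (insert z S) (fun σ => (1 + signVal (σ z)) * w σ) f = spinAverage S w f := by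
  simp only [spinAverage, mul_left_comm (f _)]
  rw [sum_one_add_spin_mul hz fun σ => f σ * w σ, sum_one_add_spin_mul hz w,
    mul_div_mul_left _ _ two_ne_zero]

variable {f : (Option V → ℤˣ) → ℝ}

/-- Conditioning on `σ_z = 1` amounts to multiplying the weight by `1 + σ_z`, which is of positive
type. -/
lemma spinAverage_plus_insert_le (hJ : ∀ e, 0 ≤ J e) (hJs : ∀ x, Summable fun y => J s(x, y))
    (hz : z ∉ G) {E : Finset (Bond V)} (hE : E ⊆ bondsIn G) (hf : PositiveType f) :
    spinAverage ((insert z G).map .some) (boltzmann (ghostCoupling J (insert z G))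
        (bondsIn (Finset.insertNone (insert z G)) \ ghostBonds E)) f ≤
      spinAverage (G.map .some) (boltzmann (ghostCoupling J G)
        (bondsIn (Finset.insertNone G) \ ghostBonds E)) f := by
  have hz' : some z ∉ G.map .some := by simpa using hz
  rw [← spinAverage_eq_of_eq_mul (Real.exp_ne_zero _) fun σ hσ =>
      boltzmann_ghostCoupling_insert_sdiff hJs hz hE (hσ _ hz') (hσ none (by simp)),
    ← spinAverage_insert_one_add_spin hz', Finset.map_insert, Function.Embedding.some_apply]
  refine spinAverage_le_spinAverage_mul (boltzmann_pos _ _)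
    (ginibreWeight_boltzmann (ghostCoupling_nonneg hJ _) _) hf
    (PositiveType.one_add_char (Pi.evalMonoidHom (fun _ : Option V => ℤˣ) (some z))) ?_
  rw [sum_one_add_spin_mul hz']
  exact mul_pos two_pos (sum_spinsOn_pos (boltzmann_pos _ _))

lemma exists_tendsto_spinAverage_plus (hJ : ∀ e, 0 ≤ J e)
    (hJs : ∀ x, Summable fun y => J s(x, y)) (E : Finset (Bond V)) (hf : PositiveType f) :
    ∃ l, Tendsto (fun G : Finset V => spinAverage (G.map .some) (boltzmann (ghostCoupling J G)
      (bondsIn (Finset.insertNone G) \ ghostBonds E)) f) atTop (𝓝 l) := by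
  obtain ⟨G₀, hG₀⟩ := exists_bondsIn_superset E
  let average (G : Finset V) : ℝ := spinAverage (G.map .some) (boltzmann (ghostCoupling J G)
    (bondsIn (Finset.insertNone G) \ ghostBonds E)) f
  have hanti : Antitone fun G => average (G₀ ∪ G) := by
    refine Finset.antitone_iff_forall_insert_le.2 fun G z _ => ?_
    rw [Finset.union_insert]
    by_cases hz : z ∈ G₀ ∪ G
    · rw [Finset.insert_eq_of_mem hz]
    · exact spinAverage_plus_insert_le hJ hJs hz
        (hG₀.trans (bondsIn_mono Finset.subset_union_left)) hf
  have hbdd : BddBelow (Set.range fun G => average (G₀ ∪ G)) := by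
    refine ⟨0, ?_⟩
    rintro _ ⟨G, rfl⟩
    exact spinAverage_nonneg (boltzmann_pos _ _)
      (positiveType_boltzmann (ghostCoupling_nonneg hJ _) _) hf
  refine ⟨_, (tendsto_atTop_ciInf hanti hbdd).congr' ?_⟩
  filter_upwards [eventually_ge_atTop G₀] with G hG
  rw [Finset.union_eq_right.2 hG]

end PlusBoundary

/-! ### Convergence of the finite-volume laws on point cylinders -/

section FiniteCurrentLaw

variable {W : Type*} [DecidableEq W] {β : ℝ} {K : Sym2 W → ℝ} {G : Finset W}
  {E : Finset (Bond W)}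

lemma isProbabilityMeasure_finiteCurrentLaw (hK : ∀ e, 0 ≤ β * K e) (S G : Finset W) :
    IsProbabilityMeasure (finiteCurrentLaw β K S G) := by
  constructor
  have h := finiteCurrentLaw_pointCylinder hK S (Finset.empty_subset (bondsIn G)) 0
  have hone : boltzmann (β • K) ∅ = fun _ => 1 := funext fun σ => Finset.prod_empty
  simpa [currentWeight, currentSpin, hone, spinAverage_const (boltzmann_pos _ _)] using h

/-- The quotient of `1` by this average is the probability that the current vanishes on `E`. -/
lemma one_le_spinAverage_boltzmann (hK : ∀ e, 0 ≤ β * K e) (S : Finset W) (hE : E ⊆ bondsIn G) :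
    1 ≤ spinAverage S (boltzmann (β • K) (bondsIn G \ E)) (boltzmann (β • K) E) := by
  have := isProbabilityMeasure_finiteCurrentLaw hK S G
  have hprob := (finiteCurrentLaw_pointCylinder hK S hE 0).symm.trans_le prob_le_one
  have hpos : 0 < spinAverage S (boltzmann (β • K) (bondsIn G \ E)) (boltzmann (β • K) E) := by
    refine div_pos ?_ (sum_spinsOn_pos (boltzmann_pos _ _))
    simp only [boltzmann_mul_sdiff hE]
    exact sum_spinsOn_pos (boltzmann_pos _ _)
  rw [ENNReal.ofReal_le_one, div_le_one hpos] at hprob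
  simpa [currentWeight, currentSpin, spinAverage_const (boltzmann_pos _ _)] using hprob

lemma finiteCurrentLaw_pointCylinder_le (hK : ∀ e, 0 ≤ β * K e) (S : Finset W)
    (hE : E ⊆ bondsIn G) (k : Current W) :
    finiteCurrentLaw β K S G (pointCylinder E k) ≤ ENNReal.ofReal (currentWeight (β • K) E k) := by
  rw [finiteCurrentLaw_pointCylinder hK S hE]
  refine ENNReal.ofReal_le_ofReal ?_
  have hw : 0 ≤ currentWeight (β • K) E k :=
    Finset.prod_nonneg fun _ _ => div_nonneg (pow_nonneg (hK _) _) (by positivity)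
  refine (div_le_self (mul_nonneg hw ?_) (one_le_spinAverage_boltzmann hK S hE)).trans
    (mul_le_of_le_one_right hw ?_)
  · exact spinAverage_nonneg (boltzmann_pos _ _) (positiveType_boltzmann hK _)
      (positiveType_currentSpin E k)
  · exact spinAverage_le (boltzmann_pos _ _) fun σ => signVal_le_one _

lemma eventually_subset_bondsIn (E : Finset (Bond W)) :
    ∀ᶠ G : Finset W in atTop, E ⊆ bondsIn G := by
  obtain ⟨G₀, h₀⟩ := exists_bondsIn_superset E
  filter_upwards [eventually_ge_atTop G₀] with G hG
  exact h₀.trans (bondsIn_mono hG)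

lemma tendsto_ofReal_mul_div {ι : Type*} {l : Filter ι} [l.NeBot] {a b : ι → ℝ} {c a' b' : ℝ}
    (ha : Tendsto a l (𝓝 a')) (hb : Tendsto b l (𝓝 b')) (hb₁ : ∀ᶠ i in l, 1 ≤ b i) :
    Tendsto (fun i => ENNReal.ofReal (c * a i / b i)) l (𝓝 (ENNReal.ofReal (c * a' / b'))) := by
  have h₁ : 1 ≤ b' := ge_of_tendsto hb hb₁
  exact ENNReal.tendsto_ofReal ((ha.const_mul c).div hb (by positivity))

lemma exists_tendsto_freeCurrentLaw (hK : ∀ e, 0 ≤ β * K e) (E : Finset (Bond W))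
    (k : Current W) :
    ∃ l, Tendsto (fun G => freeCurrentLaw K β G (pointCylinder E k)) atTop (𝓝 l) := by
  obtain ⟨G₀, h₀⟩ := exists_bondsIn_superset E
  obtain ⟨a, ha⟩ := exists_tendsto_spinAverage_free (K := β • K) (G₀ := G₀) hK E
    (positiveType_currentSpin E k)
    (fun G hG σ => by rw [currentSpin_truncateSpins (h₀.trans (bondsIn_mono hG))])
    fun σ => signVal_le_one _
  obtain ⟨b, hb⟩ := exists_tendsto_spinAverage_free (K := β • K) (G₀ := G₀) hK E
    (positiveType_boltzmann hK E)
    (fun G hG => boltzmann_truncateSpins (h₀.trans (bondsIn_mono hG)) _) (boltzmann_le hK E)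
  have hone := (eventually_subset_bondsIn E).mono fun G hG => one_le_spinAverage_boltzmann hK G hG
  refine ⟨_, (tendsto_ofReal_mul_div (c := currentWeight (β • K) E k) ha hb hone).congr' ?_⟩
  filter_upwards [eventually_subset_bondsIn E] with G hG
  exact (finiteCurrentLaw_pointCylinder hK G hG k).symm

end FiniteCurrentLaw

section PlusCurrentLaw

variable {V : Type*}

/-- The current on the graph with the ghost vertex that equals `k` on the bonds of `V` and `0` on
the bonds of the ghost vertex. -/
noncomputable def ghostExtend (k : Current V) : Current (Option V) :=
  Function.extend Bond.toGhost k 0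

lemma ghostExtend_toGhost (k : Current V) (e : Bond V) : ghostExtend k e.toGhost = k e :=
  toGhost_injective.extend_apply k 0 e

lemma measurable_forgetGhost :
    Measurable fun (n : Current (Option V)) (e : Bond V) => n e.toGhost :=
  measurable_pi_lambda _ fun e => measurable_pi_apply e.toGhost

variable [DecidableEq V] {J : Sym2 V → ℝ} {β : ℝ}

lemma plusCurrentLaw_pointCylinder (J : Sym2 V → ℝ) (β : ℝ) (G : Finset V)
    (E : Finset (Bond V)) (k : Current V) :
    plusCurrentLaw J β G (pointCylinder E k) =
      finiteCurrentLaw β (ghostCoupling J G) (G.map .some)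
        (Finset.insertNone G) (pointCylinder (ghostBonds E) (ghostExtend k)) := by
  rw [plusCurrentLaw, Measure.map_apply measurable_forgetGhost (measurableSet_pointCylinder E k)]
  congr 1
  ext n
  refine ⟨fun h e he => ?_, fun h e he => ?_⟩
  · obtain ⟨e, he', rfl⟩ := Finset.mem_map.1 he
    exact (h e he').trans (ghostExtend_toGhost k e).symm
  · exact (h e.toGhost (Finset.mem_map_of_mem _ he)).trans (ghostExtend_toGhost k e)

lemma currentWeight_ghostBonds (J : Sym2 V → ℝ) (G : Finset V) (E : Finset (Bond V))
    (k : Current V) :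
    currentWeight (ghostCoupling J G) (ghostBonds E) (ghostExtend k) = currentWeight J E k := by
  simp [currentWeight, ghostBonds, ghostExtend_toGhost]

lemma exists_tendsto_plusCurrentLaw (hβ : 0 ≤ β) (hJ : ∀ e, 0 ≤ J e)
    (hJs : ∀ x, Summable fun y => J s(x, y)) (E : Finset (Bond V)) (k : Current V) :
    ∃ l, Tendsto (fun G => plusCurrentLaw J β G (pointCylinder E k)) atTop (𝓝 l) := by
  have hK (e) : 0 ≤ (β • J) e := mul_nonneg hβ (hJ e)
  have hKs (x : V) : Summable fun y => (β • J) s(x, y) := (hJs x).mul_left β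
  have hghost (G) (e) : 0 ≤ β * ghostCoupling J G e := mul_nonneg hβ (ghostCoupling_nonneg hJ G e)
  obtain ⟨a, ha⟩ := exists_tendsto_spinAverage_plus hK hKs E
    (positiveType_currentSpin (ghostBonds E) (ghostExtend k))
  obtain ⟨b, hb⟩ := exists_tendsto_spinAverage_plus hK hKs E
    (positiveType_boltzmann (ghostCoupling_nonneg hK ∅) (ghostBonds E))
  have hone := (eventually_subset_bondsIn E).mono fun G hG =>
    one_le_spinAverage_boltzmann (hghost G) (G.map .some) (ghostBonds_subset hG)
  simp only [smul_ghostCoupling, fun G => boltzmann_ghostBonds (β • J) G ∅ E] at hone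
  refine ⟨_, (tendsto_ofReal_mul_div (c := currentWeight (β • J) E k) ha hb hone).congr' ?_⟩
  filter_upwards [eventually_subset_bondsIn E] with G hG
  rw [plusCurrentLaw_pointCylinder, finiteCurrentLaw_pointCylinder (hghost G) _
    (ghostBonds_subset hG), smul_ghostCoupling, currentWeight_ghostBonds,
    boltzmann_ghostBonds (β • J) G ∅]

lemma isProbabilityMeasure_plusCurrentLaw (hβ : 0 ≤ β) (hJ : ∀ e, 0 ≤ J e) (G : Finset V) :
    IsProbabilityMeasure (plusCurrentLaw J β G) := by
  have := isProbabilityMeasure_finiteCurrentLaw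
    (fun e => mul_nonneg hβ (ghostCoupling_nonneg hJ G e)) (G.map .some) (Finset.insertNone G)
  exact Measure.isProbabilityMeasure_map measurable_forgetGhost.aemeasurable

end PlusCurrentLaw

/-! ### Infinite-volume limits -/

lemma preimage_restrict_singleton {V : Type*} (E : Finset (Bond V)) (k : Current V) :
    E.restrict ⁻¹' ({E.restrict k} : Set (E → ℕ)) = pointCylinder E k := by
  ext n
  exact ⟨fun h e he => congrFun h ⟨e, he⟩, fun h => funext fun e => h e.1 e.2⟩

lemma measure_ext_of_pointCylinder {V : Type*} {P Q : Measure (Current V)} [IsFiniteMeasure P]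
    (E₀ : Finset (Bond V))
    (h : ∀ E : Finset (Bond V), E₀ ⊆ E → ∀ k, P (pointCylinder E k) = Q (pointCylinder E k)) :
    P = Q := by
  classical
  have hm (E : Finset (Bond V)) : Measurable (E.restrict : Current V → E → ℕ) :=
    E.measurable_restrict
  have h₁ (E : Finset (Bond V)) (hE : E₀ ⊆ E) :
      P.map E.restrict = Q.map (E.restrict : Current V → E → ℕ) := by
    refine Measure.ext_of_singleton fun a => ?_
    obtain ⟨k, rfl⟩ : ∃ k : Current V, E.restrict k = a :=
      ⟨fun e => if he : e ∈ E then a ⟨e, he⟩ else 0, by ext e; simp⟩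
    rw [Measure.map_apply (hm E) (measurableSet_singleton _),
      Measure.map_apply (hm E) (measurableSet_singleton _), preimage_restrict_singleton]
    exact h E hE k
  have h₂ (E : Finset (Bond V)) :
      Q.map E.restrict = P.map (E.restrict : Current V → E → ℕ) := by
    have hr : (E.restrict : Current V → E → ℕ) =
        Finset.restrict₂ Finset.subset_union_left ∘ (E ∪ E₀).restrict := rfl
    have hm₂ : Measurable (Finset.restrict₂ (π := fun _ : Bond V => ℕ)
        (Finset.subset_union_left : E ⊆ E ∪ E₀)) := Finset.measurable_restrict₂ _
    rw [hr, ← Measure.map_map hm₂ (hm _), ← Measure.map_map hm₂ (hm _),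
      h₁ _ Finset.subset_union_right]
  have i (E : Finset (Bond V)) : IsFiniteMeasure (P.map (E.restrict : Current V → E → ℕ)) :=
    Measure.isFiniteMeasure_map P _
  exact IsProjectiveLimit.unique (P := fun E => P.map E.restrict) (fun E => rfl) h₂

section Tightness

variable {V : Type*} [Countable V] {c : Bond V → ℕ → ℝ≥0∞}

lemma isTightMeasureSet_of_pointCylinder_le {s : Set (Measure (Current V))}
    (hc : ∀ e, ∑' m, c e m ≠ ∞) (hs : ∀ μ ∈ s, ∀ e m, μ (pointCylinder {e} fun _ => m) ≤ c e m) :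
    IsTightMeasureSet s := by
  rw [isTightMeasureSet_iff_exists_isCompact_measure_compl_le]
  intro ε hε
  obtain ⟨δ, hδ, hδε⟩ := ENNReal.exists_pos_sum_of_countable' hε.ne' (Bond V)
  have htail (e : Bond V) : ∃ N : ℕ, ∑' m : ℕ, c e (m + N) ≤ δ e :=
    ((ENNReal.tendsto_sum_nat_add _ (hc e)).eventually (ge_mem_nhds (hδ e))).exists
  choose N hN using htail
  refine ⟨Set.univ.pi fun e => Set.Iio (N e),
    isCompact_univ_pi fun e => (Set.finite_Iio (N e)).isCompact, fun μ hμ => ?_⟩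
  have hsub : (Set.univ.pi fun e => Set.Iio (N e))ᶜ ⊆
      ⋃ e, ⋃ m : ℕ, pointCylinder {e} fun _ => m + N e := by
    intro n hn
    simp only [Set.mem_compl_iff, Set.mem_univ_pi, Set.mem_Iio, not_forall, not_lt] at hn
    obtain ⟨e, he⟩ := hn
    refine Set.mem_iUnion₂.2 ⟨e, n e - N e, fun e' he' => ?_⟩
    rw [Finset.mem_singleton.1 he']
    exact (Nat.sub_add_cancel he).symm
  calc μ (Set.univ.pi fun e => Set.Iio (N e))ᶜ
      ≤ μ (⋃ e, ⋃ m : ℕ, pointCylinder {e} fun _ => m + N e) := measure_mono hsub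
    _ ≤ ∑' e, ∑' m : ℕ, μ (pointCylinder {e} fun _ => m + N e) :=
        (measure_iUnion_le _).trans (ENNReal.tsum_le_tsum fun e => measure_iUnion_le _)
    _ ≤ ∑' e, δ e := ENNReal.tsum_le_tsum fun e =>
        (ENNReal.tsum_le_tsum fun m => hs μ hμ e _).trans (hN e)
    _ ≤ ε := hδε.le

omit [Countable V] in
lemma measure_frontier_cylinder (P : Measure (Current V)) (E : Finset (Bond V))
    (A : Set (E → ℕ)) : P (frontier (cylinder E A)) = 0 := by
  have hclopen : IsClopen (cylinder E A : Set (Current V)) :=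
    (isClopen_discrete A).preimage (by fun_prop)
  rw [hclopen.frontier_eq, measure_empty]

lemma tendsto_pointCylinder_of_mapClusterPt {u : ℕ → ProbabilityMeasure (Current V)}
    {P : ProbabilityMeasure (Current V)} (hP : MapClusterPt P atTop u) {E : Finset (Bond V)}
    {k : Current V}
    (hlim : ∃ l, Tendsto (fun L => (u L : Measure (Current V)) (pointCylinder E k)) atTop (𝓝 l)) :
    Tendsto (fun L => (u L : Measure (Current V)) (pointCylinder E k)) atTop
      (𝓝 ((P : Measure (Current V)) (pointCylinder E k))) := by
  obtain ⟨U, hU, hUP⟩ := mapClusterPt_iff_ultrafilter.1 hP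
  obtain ⟨l, hl⟩ := hlim
  have hU' := ProbabilityMeasure.tendsto_measure_of_null_frontier_of_tendsto' hUP
    (measure_frontier_cylinder (P : Measure (Current V)) E {E.restrict k})
  simp only [cylinder, preimage_restrict_singleton] at hU'
  rwa [← tendsto_nhds_unique (hl.mono_left hU) hU']

lemma exists_infiniteVolumeLimit {μ : ℕ → Measure (Current V)}
    (hμ : ∀ L, IsProbabilityMeasure (μ L)) (hc : ∀ e, ∑' m, c e m ≠ ∞)
    (hle : ∀ L e m, μ L (pointCylinder {e} fun _ => m) ≤ c e m)
    (hlim : ∀ E k, ∃ l, Tendsto (fun L => μ L (pointCylinder E k)) atTop (𝓝 l)) :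
    ∃ P, IsInfiniteVolumeLimit μ P := by
  let u : ℕ → ProbabilityMeasure (Current V) := fun L => ⟨μ L, hμ L⟩
  have hcompact : IsCompact (closure (Set.range u)) := by
    refine isCompact_closure_of_isTightMeasureSet (isTightMeasureSet_of_pointCylinder_le hc ?_)
    rintro _ ⟨_, ⟨L, rfl⟩, rfl⟩
    exact hle L
  have hrange : ∀ᶠ L in atTop, u L ∈ closure (Set.range u) :=
    Eventually.of_forall fun L => subset_closure ⟨L, rfl⟩
  obtain ⟨P, -, hP⟩ := hcompact.exists_mapClusterPt (f := atTop) (tendsto_principal.2 hrange)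
  have hlimP : Tendsto u atTop (𝓝 P) := by
    refine hcompact.le_nhds_of_unique_clusterPt (mem_map.2 hrange) fun Q _ hQ => ?_
    have : IsProbabilityMeasure Q.1 := Q.2
    refine Subtype.ext (measure_ext_of_pointCylinder ∅ fun E _ k => ?_)
    exact tendsto_nhds_unique (tendsto_pointCylinder_of_mapClusterPt hQ (hlim E k))
      (tendsto_pointCylinder_of_mapClusterPt hP (hlim E k))
  exact ⟨P, P.2, fun E A => ProbabilityMeasure.tendsto_measure_of_null_frontier_of_tendsto' hlimP
    (measure_frontier_cylinder _ E A)⟩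

end Tightness

section SingletonBound

lemma tsum_currentWeight_singleton_ne_top {V : Type*} (K : Sym2 V → ℝ) (e : Bond V) :
    ∑' m : ℕ, ENNReal.ofReal (currentWeight K {e} fun _ => m) ≠ ∞ := by
  have h : Summable fun m : ℕ => currentWeight K {e} fun _ => m := by
    simpa [currentWeight] using Real.summable_pow_div_factorial (K e.1)
  exact h.tsum_ofReal_ne_top

variable {W : Type*} [DecidableEq W]

lemma finiteCurrentLaw_ne_zero (β : ℝ) (K : Sym2 W → ℝ) (S : Finset W) {G : Finset W}
    {e : Bond W} (he : e ∉ bondsIn G) : finiteCurrentLaw β K S G {n | n e ≠ 0} = 0 := by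
  have hm : MeasurableSet {n : Current W | n e ≠ 0} :=
    measurable_pi_apply e (measurableSet_singleton 0).compl
  rw [finiteCurrentLaw, Measure.sum_apply _ hm]
  simp only [Measure.smul_apply, Measure.dirac_apply' _ hm]
  refine ENNReal.tsum_eq_zero.2 fun n => ?_
  simp [FinCurrent.extend, he]

lemma finiteCurrentLaw_singleton_le {β : ℝ} {K : Sym2 W → ℝ} (hK : ∀ e, 0 ≤ β * K e)
    (S G : Finset W) (e : Bond W) (m : ℕ) :
    finiteCurrentLaw β K S G (pointCylinder {e} fun _ => m) ≤
      ENNReal.ofReal (currentWeight (β • K) {e} fun _ => m) := by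
  by_cases he : e ∈ bondsIn G
  · exact finiteCurrentLaw_pointCylinder_le hK S (Finset.singleton_subset_iff.2 he) _
  · rcases eq_or_ne m 0 with rfl | hm
    · have := isProbabilityMeasure_finiteCurrentLaw hK S G
      simpa [currentWeight] using prob_le_one
    · refine (measure_mono fun n hn => ?_).trans
        ((finiteCurrentLaw_ne_zero β K S he).trans_le zero_le)
      rw [Set.mem_ofPred_eq, hn e (Finset.mem_singleton_self e)]
      exact hm

lemma plusCurrentLaw_singleton_le {J : Sym2 W → ℝ} {β : ℝ} (hβ : 0 ≤ β) (hJ : ∀ e, 0 ≤ J e)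
    (G : Finset W) (e : Bond W) (m : ℕ) :
    plusCurrentLaw J β G (pointCylinder {e} fun _ => m) ≤
      ENNReal.ofReal (currentWeight (β • J) {e} fun _ => m) := by
  have h := finiteCurrentLaw_singleton_le
    (fun e => mul_nonneg hβ (ghostCoupling_nonneg hJ G e)) (G.map .some)
    (Finset.insertNone G) e.toGhost m
  rw [plusCurrentLaw_pointCylinder]
  convert h using 2
  · ext n; simp [pointCylinder, ghostBonds, ghostExtend_toGhost]
  · simp [currentWeight]

end SingletonBound

lemma tendsto_latticeBox (d : ℕ) : Tendsto (latticeBox d) atTop atTop := by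
  refine tendsto_atTop_finset_of_monotone (fun L L' h => ?_) fun x => ?_
  · refine Finset.Icc_subset_Icc (fun _ => ?_) fun _ => ?_ <;> simp only <;> omega
  · refine ⟨∑ i, (x i).natAbs, Finset.mem_Icc.2 ⟨fun i => ?_, fun i => ?_⟩⟩ <;>
    · have : (x i).natAbs ≤ ∑ i, (x i).natAbs :=
        Finset.single_le_sum (f := fun i => (x i).natAbs) (fun _ _ => zero_le) (Finset.mem_univ i)
      simp only
      omega

lemma IsInfiniteVolumeLimit.tendsto_pointCylinder {V : Type*} {μ : ℕ → Measure (Current V)}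
    {P : Measure (Current V)} (hP : IsInfiniteVolumeLimit μ P) (E : Finset (Bond V))
    (k : Current V) :
    Tendsto (fun L => μ L (pointCylinder E k)) atTop (𝓝 (P (pointCylinder E k))) := by
  rw [← preimage_restrict_singleton]
  exact hP.tendsto E {E.restrict k}

lemma IsInfiniteVolumeLimit.tendsto_net {d : ℕ}
    {μ : Finset (Fin d → ℤ) → Measure (Current (Fin d → ℤ))} {P : Measure (Current (Fin d → ℤ))}
    (hP : IsInfiniteVolumeLimit (fun L => μ (latticeBox d L)) P)
    (hlim : ∀ E k, ∃ l, Tendsto (fun G => μ G (pointCylinder E k)) atTop (𝓝 l))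
    (E : Finset (Bond (Fin d → ℤ))) (k : Current (Fin d → ℤ)) :
    Tendsto (fun G => μ G (pointCylinder E k)) atTop (𝓝 (P (pointCylinder E k))) := by
  obtain ⟨l, hl⟩ := hlim E k
  rwa [tendsto_nhds_unique (hP.tendsto_pointCylinder E k) (hl.comp (tendsto_latticeBox d))]

/-! ### Covariance under bijections of the vertex set -/

section Covariance

variable {V W : Type*}

/-- The bijection between bonds induced by a bijection between vertices. -/
def Bond.congr (θ : V ≃ W) : Bond V ≃ Bond W where
  toFun e := ⟨e.1.map θ, fun h => e.2 ((Sym2.isDiag_map θ.injective).1 h)⟩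
  invFun e := ⟨e.1.map θ.symm, fun h => e.2 ((Sym2.isDiag_map θ.symm.injective).1 h)⟩
  left_inv e := Subtype.ext (by simp [Sym2.map_map])
  right_inv e := Subtype.ext (by simp [Sym2.map_map])

@[simp] lemma Bond.congr_val (θ : V ≃ W) (e : Bond V) : (Bond.congr θ e).1 = e.1.map θ := rfl

lemma Bond.congr_toGhost (θ : V ≃ W) (e : Bond V) :
    Bond.congr (Equiv.optionCongr θ) e.toGhost = (Bond.congr θ e).toGhost :=
  Subtype.ext (by simp [Bond.toGhost, Sym2.map_map])

lemma measurable_comp_congr {α : Type*} [MeasurableSpace α] (θ : V ≃ W) :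
    Measurable fun n : Bond W → α => n ∘ Bond.congr θ :=
  measurable_pi_lambda _ fun _ => measurable_pi_apply _

variable [DecidableEq V] [DecidableEq W]

lemma congr_mem_bondsIn_map {θ : V ≃ W} {G : Finset V} {e : Bond V} :
    Bond.congr θ e ∈ bondsIn (G.map θ.toEmbedding) ↔ e ∈ bondsIn G := by
  simp [mem_bondsIn, Sym2.mem_map]

/-- The bijection between currents on finite sets induced by a bijection between vertices. -/
def FinCurrent.congr (θ : V ≃ W) (G : Finset V) :
    FinCurrent (G.map θ.toEmbedding) ≃ FinCurrent G :=
  (((Bond.congr θ).subtypeEquiv fun _ => congr_mem_bondsIn_map.symm).arrowCongr (.refl ℕ)).symm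

namespace FinCurrent

variable {θ : V ≃ W} {G : Finset V} (n : FinCurrent (G.map θ.toEmbedding))

lemma congr_apply (e : bondsIn G) :
    congr θ G n e = n ⟨Bond.congr θ e, congr_mem_bondsIn_map.2 e.2⟩ := rfl

lemma extend_congr : (congr θ G n).extend = n.extend ∘ Bond.congr θ := by
  ext e
  simp [FinCurrent.extend, congr_mem_bondsIn_map, congr_apply]

lemma flux_congr (x : V) : (congr θ G n).flux x = n.flux (θ x) := by
  refine Finset.sum_equiv ((Bond.congr θ).subtypeEquiv fun _ => congr_mem_bondsIn_map.symm)
    (fun e => ?_) fun _ _ => rfl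
  simp [Sym2.mem_map]

lemma sources_map (S : Finset V) :
    n.sources (S.map θ.toEmbedding) = ((congr θ G n).sources S).map θ.toEmbedding := by
  simp only [sources, Finset.filter_map, flux_congr]
  rfl

variable {β : ℝ} {K : Sym2 V → ℝ} {K' : Sym2 W → ℝ}

lemma weight_congr (hK : ∀ e, K' (e.map θ) = K e) :
    (congr θ G n).weight β K = n.weight β K' :=
  Fintype.prod_equiv ((Bond.congr θ).subtypeEquiv fun _ => congr_mem_bondsIn_map.symm) _ _
    fun e => by simp [← hK, congr_apply]

lemma sourcelessWeight_congr (hK : ∀ e, K' (e.map θ) = K e) (S : Finset V) :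
    (congr θ G n).sourcelessWeight β K S = n.sourcelessWeight β K' (S.map θ.toEmbedding) := by
  simp only [sourcelessWeight, sources_map, Finset.map_eq_empty, weight_congr n hK]

end FinCurrent

lemma finiteCurrentLaw_map {θ : V ≃ W} {K : Sym2 V → ℝ} {K' : Sym2 W → ℝ} (β : ℝ)
    (hK : ∀ e, K' (e.map θ) = K e) (S G : Finset V) :
    (finiteCurrentLaw β K' (S.map θ.toEmbedding) (G.map θ.toEmbedding)).map
      (fun n => n ∘ Bond.congr θ) = finiteCurrentLaw β K S G := by
  have hm : Measurable fun n : Current W => n ∘ Bond.congr θ := measurable_comp_congr θ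
  simp only [finiteCurrentLaw, Measure.map_sum hm.aemeasurable, Measure.map_smul,
    Measure.map_dirac' hm, ← FinCurrent.extend_congr, ← FinCurrent.sourcelessWeight_congr _ hK]
  rw [(FinCurrent.congr θ G).tsum_eq fun n => n.sourcelessWeight β K S]
  exact Measure.sum_comp_equiv (FinCurrent.congr θ G) fun n => (n.sourcelessWeight β K S /
    ∑' m : FinCurrent G, m.sourcelessWeight β K S) • Measure.dirac n.extend

lemma freeCurrentLaw_map {θ : V ≃ W} {J : Sym2 V → ℝ} {J' : Sym2 W → ℝ} (β : ℝ)
    (hJ : ∀ e, J' (e.map θ) = J e) (G : Finset V) :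
    (freeCurrentLaw J' β (G.map θ.toEmbedding)).map (fun n => n ∘ Bond.congr θ) =
      freeCurrentLaw J β G :=
  finiteCurrentLaw_map β hJ G G

lemma ghostCoupling_map {θ : V ≃ W} {J : Sym2 V → ℝ} {J' : Sym2 W → ℝ}
    (hJ : ∀ e, J' (e.map θ) = J e) (G : Finset V) (e : Sym2 (Option V)) :
    ghostCoupling J' (G.map θ.toEmbedding) (e.map (Equiv.optionCongr θ)) =
      ghostCoupling J G e := by
  have h (x : V) : (∑' y, if y ∈ G.map θ.toEmbedding then 0 else J' s(θ x, y)) =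
      ∑' y, if y ∈ G then 0 else J s(x, y) := by
    rw [← θ.tsum_eq]
    refine tsum_congr fun y => ?_
    rw [← hJ s(x, y)]
    simp
  induction e with
  | h a b =>
    rcases a with _ | a <;> rcases b with _ | b
    exacts [rfl, h b, h a, hJ s(a, b)]

lemma plusCurrentLaw_map {θ : V ≃ W} {J : Sym2 V → ℝ} {J' : Sym2 W → ℝ} (β : ℝ)
    (hJ : ∀ e, J' (e.map θ) = J e) (G : Finset V) :
    (plusCurrentLaw J' β (G.map θ.toEmbedding)).map (fun n => n ∘ Bond.congr θ) =
      plusCurrentLaw J β G := by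
  have hsome : (G.map θ.toEmbedding).map .some =
      (G.map .some).map (Equiv.optionCongr θ).toEmbedding := by
    rw [Finset.map_map, Finset.map_map]
    rfl
  have hinsert : Finset.insertNone (G.map θ.toEmbedding) =
      (Finset.insertNone G).map (Equiv.optionCongr θ).toEmbedding := by
    ext x
    obtain ⟨x, rfl⟩ := (Equiv.optionCongr θ).surjective x
    rw [Finset.mem_map_equiv, Equiv.symm_apply_apply]
    cases x <;> simp
  have hcomp : (fun n : Current W => n ∘ Bond.congr θ) ∘ (fun n e => n e.toGhost) =
      (fun n e => n e.toGhost) ∘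
        fun n : Current (Option W) => n ∘ Bond.congr (Equiv.optionCongr θ) := by
    ext n e
    simp [Bond.congr_toGhost]
  rw [plusCurrentLaw, plusCurrentLaw,
    Measure.map_map (measurable_comp_congr θ) measurable_forgetGhost, hcomp,
    ← Measure.map_map measurable_forgetGhost (measurable_comp_congr _), hsome, hinsert,
    finiteCurrentLaw_map β (ghostCoupling_map hJ G)]

end Covariance

section Invariance

variable {V : Type*}

lemma preimage_comp_congr_pointCylinder (θ : V ≃ V) (E : Finset (Bond V)) (k : Current V) :
    (fun n : Current V => n ∘ Bond.congr θ) ⁻¹' pointCylinder E k =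
      pointCylinder (E.map (Bond.congr θ).toEmbedding) (k ∘ (Bond.congr θ).symm) := by
  ext n
  simp only [pointCylinder, Set.mem_preimage, Set.mem_ofPred_eq, Finset.forall_mem_map,
    Function.comp_apply, Equiv.coe_toEmbedding, Equiv.symm_apply_apply]

lemma map_comp_congr_of_tendsto {μ : Finset V → Measure (Current V)} {P : Measure (Current V)}
    [IsFiniteMeasure P] {θ : V ≃ V}
    (hP : ∀ E k, Tendsto (fun G => μ G (pointCylinder E k)) atTop (𝓝 (P (pointCylinder E k))))
    (hμ : ∀ G, (μ (G.map θ.toEmbedding)).map (fun n => n ∘ Bond.congr θ) = μ G) :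
    P.map (fun n => n ∘ Bond.congr θ) = P := by
  have hm : Measurable fun n : Current V => n ∘ Bond.congr θ := measurable_comp_congr θ
  have hθ : Tendsto (fun G : Finset V => G.map θ.toEmbedding) atTop atTop :=
    tendsto_atTop_finset_of_monotone (fun _ _ h => Finset.map_subset_map.2 h)
      fun x => ⟨{θ.symm x}, by simp⟩
  have := Measure.isFiniteMeasure_map P fun n : Current V => n ∘ Bond.congr θ
  refine measure_ext_of_pointCylinder ∅ fun E _ k => tendsto_nhds_unique ?_ (hP E k)
  have hE := measurableSet_pointCylinder E k
  rw [Measure.map_apply hm hE, preimage_comp_congr_pointCylinder]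
  refine ((hP _ _).comp hθ).congr fun G => ?_
  rw [Function.comp_apply, ← preimage_comp_congr_pointCylinder, ← Measure.map_apply hm hE, hμ]

end Invariance

/-! ### Insertion tolerance -/

section InsertionTolerance

variable {V : Type*} [DecidableEq V]

lemma currentSpin_add_two (E : Finset (Bond V)) (k : Current V) (e : Bond V) :
    currentSpin E (k + Pi.single e 2) = currentSpin E k := by
  ext σ : 1
  simp only [currentSpin_apply, Pi.add_apply, pow_add, Finset.prod_mul_distrib]
  refine mul_eq_left.2 (Finset.prod_eq_one fun e' _ => ?_)
  rw [Pi.single_apply]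
  split_ifs
  exacts [Int.units_sq _, pow_zero _]

lemma currentWeight_add_two (K : Sym2 V → ℝ) {E : Finset (Bond V)} {e : Bond V} (he : e ∈ E)
    (k : Current V) :
    currentWeight K E (k + Pi.single e 2) =
      K e.1 ^ 2 / ((k e + 1) * (k e + 2)) * currentWeight K E k := by
  rw [currentWeight, currentWeight, ← Finset.mul_prod_erase E _ he,
    ← Finset.mul_prod_erase E (fun e => K e.1 ^ k e / ((k e)! : ℝ)) he, ← mul_assoc]
  congr 1
  · rw [Pi.add_apply, Pi.single_eq_same, pow_add, Nat.factorial_succ, Nat.factorial_succ]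
    have := Nat.factorial_pos (k e)
    push_cast
    field_simp
    ring
  · refine Finset.prod_congr rfl fun e' he' => ?_
    rw [Pi.add_apply, Pi.single_eq_of_ne (Finset.ne_of_mem_erase he'), add_zero]

lemma finiteCurrentLaw_add_two {β : ℝ} {K : Sym2 V → ℝ} (hK : ∀ e, 0 ≤ β * K e) (S : Finset V)
    {G : Finset V} {E : Finset (Bond V)} (hE : E ⊆ bondsIn G) {e : Bond V} (he : e ∈ E)
    (k : Current V) :
    finiteCurrentLaw β K S G (pointCylinder E (k + Pi.single e 2)) =
      ENNReal.ofReal ((β * K e.1) ^ 2 / ((k e + 1) * (k e + 2))) *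
        finiteCurrentLaw β K S G (pointCylinder E k) := by
  rw [finiteCurrentLaw_pointCylinder hK _ hE, finiteCurrentLaw_pointCylinder hK _ hE,
    currentSpin_add_two, currentWeight_add_two _ he, ← ENNReal.ofReal_mul (by positivity),
    mul_assoc, mul_div_assoc, Pi.smul_apply, smul_eq_mul]

lemma measurable_add_two (e : Bond V) : Measurable fun n : Current V => n + Pi.single e 2 :=
  measurable_pi_lambda _ fun e' => (measurable_pi_apply e').add_const _

lemma preimage_add_two_pointCylinder (E : Finset (Bond V)) (e : Bond V) (k : Current V) :
    (fun n : Current V => n + Pi.single e 2) ⁻¹' pointCylinder E (k + Pi.single e 2) =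
      pointCylinder E k := by
  ext n
  simp [pointCylinder]

lemma map_add_two_withDensity {P : Measure (Current V)} [IsFiniteMeasure P] {e : Bond V}
    {c : ℕ → ℝ≥0∞}
    (hP : ∀ E, e ∈ E → ∀ k, P (pointCylinder E (k + Pi.single e 2)) =
      c (k e) * P (pointCylinder E k)) :
    (P.withDensity fun n => c (n e)).map (fun n => n + Pi.single e 2) =
      P.restrict {n | 2 ≤ n e} := by
  symm
  refine measure_ext_of_pointCylinder {e} fun E heE k => ?_
  have he : e ∈ E := Finset.singleton_subset_iff.1 heE
  have hE := measurableSet_pointCylinder E k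
  rw [Measure.restrict_apply hE, Measure.map_apply (measurable_add_two e) hE]
  by_cases hk : 2 ≤ k e
  · have hle : Pi.single e 2 ≤ k := fun e' => by
      rcases eq_or_ne e' e with rfl | h
      · rwa [Pi.single_eq_same]
      · rw [Pi.single_eq_of_ne h]
        exact zero_le
    obtain ⟨k, rfl⟩ := le_iff_exists_add'.1 hle
    have hsub : pointCylinder E (k + Pi.single e 2) ⊆ {n | 2 ≤ n e} := fun n hn =>
      hk.trans_eq (hn e he).symm
    have hcyl := measurableSet_pointCylinder E k
    rw [Set.inter_eq_left.2 hsub, preimage_add_two_pointCylinder, withDensity_apply _ hcyl,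
      setLIntegral_congr_fun hcyl fun n hn => congrArg c (hn e he), setLIntegral_const, hP E he]
  · have hleft : pointCylinder E k ∩ {n | 2 ≤ n e} = ∅ :=
      Set.eq_empty_of_forall_notMem fun n hn => hk (hn.2.trans_eq (hn.1 e he))
    have hright : (fun n : Current V => n + Pi.single e 2) ⁻¹' pointCylinder E k = ∅ :=
      Set.eq_empty_of_forall_notMem fun n hn => hk <| (hn e he).symm ▸ by simp
    rw [hleft, hright, measure_empty, measure_empty]

lemma map_add_two_absolutelyContinuous {β : ℝ} {J : Sym2 V → ℝ} (hJ : ∀ e, 0 ≤ β * J e)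
    {P : Measure (Current V)} [IsFiniteMeasure P]
    (hP : ∀ E k, Tendsto (fun G => freeCurrentLaw J β G (pointCylinder E k)) atTop
      (𝓝 (P (pointCylinder E k)))) {e : Bond V} (he : 0 < β * J e.1) :
    P.map (fun n => n + Pi.single e 2) ≪ P := by
  let c (m : ℕ) : ℝ≥0∞ := ENNReal.ofReal ((β * J e.1) ^ 2 / ((m + 1) * (m + 2)))
  have hc (m) : c m ≠ 0 := (ENNReal.ofReal_pos.2 (by positivity)).ne'
  have hPc (E : Finset (Bond V)) (heE : e ∈ E) (k : Current V) :
      P (pointCylinder E (k + Pi.single e 2)) = c (k e) * P (pointCylinder E k) := by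
    refine tendsto_nhds_unique ((hP E (k + Pi.single e 2)).congr' ?_)
      (ENNReal.Tendsto.const_mul (hP E k) (Or.inr ENNReal.ofReal_ne_top))
    filter_upwards [eventually_subset_bondsIn E] with G hG
    exact finiteCurrentLaw_add_two hJ G hG heE k
  have hdens : P ≪ P.withDensity fun n => c (n e) :=
    withDensity_absolutelyContinuous' ((measurable_of_countable c).comp
      (measurable_pi_apply e)).aemeasurable (Eventually.of_forall fun n => hc (n e))
  refine (hdens.map (measurable_add_two e)).trans ?_
  rw [map_add_two_withDensity hPc]
  exact Measure.restrict_le_self.absolutelyContinuous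

end InsertionTolerance

/-! ### Furcations -/

section Furcation

variable {V : Type*} {H H' : SimpleGraph V} {B B' : Set V}

/-- The graph of the edges of `H` with both endpoints in `B`, on all vertices. The branches of `H`
at `B` are the components of `within H Bᶜ` that lie outside `B`; the vertices of `B` are isolated in
`within H Bᶜ`. -/
def within (H : SimpleGraph V) (B : Set V) : SimpleGraph V :=
  (H.induce B).spanningCoe

lemma within_adj {u v : V} : (within H B).Adj u v ↔ H.Adj u v ∧ u ∈ B ∧ v ∈ B := by
  simp [within, and_assoc, and_comm, and_left_comm]

lemma within_le : within H B ≤ H :=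
  SimpleGraph.spanningCoe_induce_le H B

lemma within_mono (h : B ⊆ B') : within H B ≤ within H B' := fun _ _ huv =>
  have ⟨hadj, hu, hv⟩ := within_adj.1 huv
  within_adj.2 ⟨hadj, h hu, h hv⟩

lemma within_reachable (hB : (H.induce B).Preconnected) {u v : V} (hu : u ∈ B) (hv : v ∈ B) :
    (within H B).Reachable u v :=
  (hB ⟨u, hu⟩ ⟨v, hv⟩).map (SimpleGraph.Embedding.spanningCoe (H.induce B)).toHom

lemma mem_of_within_reachable {u v : V} (hu : u ∈ B) (h : (within H B).Reachable u v) :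
    v ∈ B := by
  rw [SimpleGraph.reachable_iff_reflTransGen] at h
  induction h with
  | refl => exact hu
  | tail _ hab _ => exact (within_adj.1 hab).2.2

lemma within_reachable_of_forall_mem {u v : V} (h : (within H B).Reachable u v)
    (hB' : ∀ w, (within H B).Reachable u w → w ∈ B') : (within H B').Reachable u v := by
  rw [SimpleGraph.reachable_iff_reflTransGen] at h
  induction h with
  | refl => exact .refl _
  | tail hua hab ih =>
    rw [← SimpleGraph.reachable_iff_reflTransGen] at hua
    have hab' := within_adj.2 ⟨within_le hab, hB' _ hua, hB' _ (hua.trans hab.reachable)⟩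
    exact ih.trans hab'.reachable

lemma exists_entry {v b : V} (hb : b ∈ B) (h : H.Reachable v b) (hv : v ∉ B) :
    ∃ u w, (within H Bᶜ).Reachable v u ∧ H.Adj u w ∧ w ∈ B := by
  rw [SimpleGraph.reachable_iff_reflTransGen] at h
  induction h using Relation.ReflTransGen.head_induction_on with
  | refl => exact absurd hb hv
  | @head v c hvc _ ih =>
    by_cases hc : c ∈ B
    · exact ⟨v, c, .refl _, hvc, hc⟩
    · obtain ⟨u, w, hcu, huw, hw⟩ := ih hc
      exact ⟨u, w, (within_adj.2 ⟨hvc, hv, hc⟩).reachable.trans hcu, huw, hw⟩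

/-- The vertices `x i` lie in pairwise distinct infinite clusters of `H`. -/
structure DistinctInfiniteClusters {ι : Type*} (H : SimpleGraph V) (x : ι → V) : Prop where
  infinite : ∀ i, {v | H.Reachable (x i) v}.Infinite
  pairwise : Pairwise fun i j => ¬ H.Reachable (x i) (x j)

/-- A connected set `B` whose removal leaves at least three infinite branches in its cluster. -/
structure IsFurcation (H : SimpleGraph V) (B : Set V) : Prop where
  preconnected : (H.induce B).Preconnected
  branches : ∃ b ∈ B, ∃ u : Fin 3 → V,
    (∀ i, u i ∉ B ∧ H.Reachable (u i) b) ∧ DistinctInfiniteClusters (within H Bᶜ) u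

/-- The outer vertex boundary of `S` in `H`. -/
def outerBoundary (H : SimpleGraph V) (S : Set V) : Set V :=
  {y | y ∉ S ∧ ∃ x ∈ S, H.Adj x y}

lemma exists_mem_outerBoundary {S : Set V} (hS : S.Finite) (hB : B ⊆ S) {u b : V} (hb : b ∈ B)
    (hu : u ∉ B) (hub : H.Reachable u b) (hinf : {v | (within H Bᶜ).Reachable u v}.Infinite) :
    ∃ y ∈ outerBoundary H S, (within H Bᶜ).Reachable u y := by
  obtain ⟨a, w, hua, haw, hw⟩ := exists_entry hb hub hu
  by_cases ha : a ∈ S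
  · obtain ⟨z, huz, hz⟩ := hinf.exists_notMem_finite hS
    obtain ⟨c, y, hzc, hcy, hy⟩ := exists_entry (H := within H Bᶜ) ha (huz.symm.trans hua) hz
    have hc : c ∈ Sᶜ := mem_of_within_reachable (B := Sᶜ) hz hzc
    exact ⟨c, ⟨hc, y, hy, (within_le hcy).symm⟩, huz.trans (hzc.mono within_le)⟩
  · exact ⟨a, ⟨ha, w, hB hw, haw.symm⟩, hua⟩

/-- The two boundary vertices used to count furcations inside a finite set: `y` is the vertex of `Y`
of least rank in its branch at `B`, another branch contains a vertex `y'` of `Y` of smaller rank,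
and neither branch contains the root `r`. -/
structure BranchSelection (H : SimpleGraph V) (Y : Set V) (ρ : V → ℕ) (B : Set V)
    (r y y' : V) : Prop where
  mem : y ∈ Y
  mem' : y' ∈ Y
  not_root : ¬ (within H Bᶜ).Reachable y r
  not_root' : ¬ (within H Bᶜ).Reachable y' r
  lt : ρ y' < ρ y
  min : ∀ z ∈ Y, (within H Bᶜ).Reachable y z → ρ y ≤ ρ z
  reachable : ∃ b ∈ B, H.Reachable y b
  reachable' : ∃ b ∈ B, H.Reachable y' b

lemma exists_reachable_forall_le {Y : Set V} (ρ : V → ℕ) {u : V} (h : ∃ y ∈ Y, H.Reachable u y) :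
    ∃ y ∈ Y, H.Reachable u y ∧ ∀ z ∈ Y, H.Reachable u z → ρ y ≤ ρ z := by
  obtain ⟨hY, hu⟩ := Function.argminOn_mem ρ {y ∈ Y | H.Reachable u y} h
  exact ⟨_, hY, hu, fun z hz huz => Function.argminOn_le ρ {y ∈ Y | H.Reachable u y} ⟨hz, huz⟩⟩

lemma exists_ne_not_reachable {u : Fin 3 → V} (hne : Pairwise fun i j => ¬ H.Reachable (u i) (u j))
    (r : V) : ∃ i j, i ≠ j ∧ ¬ H.Reachable (u i) r ∧ ¬ H.Reachable (u j) r := by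
  have hunique {i j : Fin 3} (hi : H.Reachable (u i) r) (hij : i ≠ j) : ¬ H.Reachable (u j) r :=
    fun hj => hne hij (hi.trans hj.symm)
  by_cases h0 : H.Reachable (u 0) r
  · exact ⟨1, 2, by decide, hunique h0 (by decide), hunique h0 (by decide)⟩
  by_cases h1 : H.Reachable (u 1) r
  · exact ⟨0, 2, by decide, h0, hunique h1 (by decide)⟩
  · exact ⟨0, 1, by decide, h0, h1⟩

lemma IsFurcation.exists_branchSelection {S : Set V} (hS : S.Finite) (hB : B ⊆ S)
    (h : IsFurcation H B) {ρ : V → ℕ} (hρ : Function.Injective ρ) (r : V) :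
    ∃ y y', BranchSelection H (outerBoundary H S) ρ B r y y' := by
  obtain ⟨b, hb, u, hu, hclusters⟩ := h.branches
  obtain ⟨i, j, hij, hi, hj⟩ := exists_ne_not_reachable hclusters.pairwise r
  choose y hy huy hmin using fun i => exists_reachable_forall_le ρ
    (exists_mem_outerBoundary hS hB hb (hu i).1 (hu i).2 (hclusters.infinite i))
  have hyb (i : Fin 3) : ∃ b ∈ B, H.Reachable (y i) b :=
    ⟨b, hb, ((huy i).mono within_le).symm.trans (hu i).2⟩
  have hρy : ρ (y i) ≠ ρ (y j) := fun h =>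
    hclusters.pairwise hij ((huy i).trans (hρ h ▸ (huy j).symm))
  wlog hlt : ρ (y j) < ρ (y i) generalizing i j
  · exact this j i hij.symm hj hi hρy.symm (hρy.lt_or_gt.resolve_right hlt)
  exact ⟨y i, y j,
    { mem := hy i
      mem' := hy j
      not_root := fun hr => hi ((huy i).trans hr)
      not_root' := fun hr => hj ((huy j).trans hr)
      lt := hlt
      min := fun z hz hyz => hmin i z hz ((huy i).trans hyz)
      reachable := hyb i
      reachable' := hyb j }⟩

lemma reachable_within_compl_of_not_reachable (hBB' : Disjoint B B')
    (hB : (H.induce B).Preconnected) (hB' : (H.induce B').Preconnected) {y v b b' : V}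
    (hb' : b' ∈ B') (hyb' : (within H Bᶜ).Reachable y b') (hb : b ∈ B) (hvb : H.Reachable v b)
    (hyv : ¬ (within H Bᶜ).Reachable y v) : (within H B'ᶜ).Reachable v b := by
  have hBb {x : V} (hx : x ∈ B) : (within H B'ᶜ).Reachable x b :=
    (within_reachable hB hx hb).mono (within_mono hBB'.subset_compl_right)
  by_cases hv : v ∈ B
  · exact hBb hv
  obtain ⟨u, w, hvu, huw, hw⟩ := exists_entry hb hvb hv
  have hout (x : V) (hx : (within H Bᶜ).Reachable v x) : x ∈ B'ᶜ := fun hxB' =>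
    hyv ((hyb'.trans ((within_reachable hB' hb' hxB').mono
      (within_mono hBB'.subset_compl_left))).trans hx.symm)
  have huw' : (within H B'ᶜ).Adj u w :=
    within_adj.2 ⟨huw, hout u hvu, hBB'.subset_compl_right hw⟩
  exact ((within_reachable_of_forall_mem hvu hout).trans huw'.reachable).trans (hBb hw)

lemma BranchSelection.not_reachable {Y : Set V} {ρ : V → ℕ} {r y y₁ y₂ : V} (hBB' : Disjoint B B')
    (hB : (H.induce B).Preconnected) (hB' : (H.induce B').Preconnected)
    (h₁ : BranchSelection H Y ρ B r y y₁) (h₂ : BranchSelection H Y ρ B' r y y₂)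
    (hr : H.Reachable y r) {b' : V} (hb' : b' ∈ B') : ¬ (within H Bᶜ).Reachable y b' := by
  intro hyb'
  obtain ⟨b, hb, hyb⟩ := h₁.reachable
  obtain ⟨c, hc, hyc⟩ := h₂.reachable'
  have hb'b : H.Reachable b' b := (hyb'.symm.mono within_le).trans hyb
  have hcb : H.Reachable c b := ((within_reachable hB' hc hb').mono within_le).trans hb'b
  have hrb : (within H B'ᶜ).Reachable r b :=
    reachable_within_compl_of_not_reachable hBB' hB hB' hb' hyb' hb (hr.symm.trans hyb) h₁.not_root
  have hyy₂ : (within H Bᶜ).Reachable y y₂ := by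
    by_contra hyy₂
    exact h₂.not_root' ((reachable_within_compl_of_not_reachable hBB' hB hB' hb' hyb' hb
      (hyc.trans hcb) hyy₂).trans hrb.symm)
  exact (h₁.min y₂ h₂.mem' hyy₂).not_gt h₂.lt

lemma BranchSelection.ne_of_disjoint {Y : Set V} {ρ : V → ℕ} {r y y' y₁ y₂ : V}
    (hYB : Disjoint Y B) (hBB' : Disjoint B B') (hB : (H.induce B).Preconnected)
    (hB' : (H.induce B').Preconnected) (h₁ : BranchSelection H Y ρ B r y y₁)
    (h₂ : BranchSelection H Y ρ B' r y' y₂) (hr : H.Reachable y r) : y ≠ y' := by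
  rintro rfl
  have hout (x : V) (hx : (within H Bᶜ).Reachable y x) : x ∈ B'ᶜ := fun hxB' =>
    h₁.not_reachable hBB' hB hB' h₂ hr hxB' hx
  obtain ⟨b, hb, hyb⟩ := h₁.reachable
  obtain ⟨u, w, hyu, huw, hw⟩ := exists_entry hb hyb (Set.disjoint_left.1 hYB h₁.mem)
  have huw' : (within H B'ᶜ).Adj u w :=
    within_adj.2 ⟨huw, hout u hyu, hBB'.subset_compl_right hw⟩
  exact h₂.not_reachable hBB'.symm hB' hB h₁ hr hw
    ((within_reachable_of_forall_mem hyu hout).trans huw'.reachable)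

lemma IsFurcation.exists_root {S : Set V} (hS : S.Finite) (hB : B ⊆ S) (h : IsFurcation H B)
    {ρ : V → ℕ} (hρ : Function.Injective ρ) :
    ∃ r y y', BranchSelection H (outerBoundary H S) ρ B r y y' ∧ r ∈ outerBoundary H S ∧
      H.Reachable y r ∧ ∀ z ∈ outerBoundary H S, H.Reachable y z → ρ r ≤ ρ z := by
  obtain ⟨b, hb, u, hu, hclusters⟩ := h.branches
  obtain ⟨z, hz, huz⟩ :=
    exists_mem_outerBoundary hS hB hb (hu 0).1 (hu 0).2 (hclusters.infinite 0)
  obtain ⟨r, hr, hbr, hmin⟩ := exists_reachable_forall_le ρ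
    ⟨z, hz, (hu 0).2.symm.trans (huz.mono within_le)⟩
  obtain ⟨y, y', hsel⟩ := h.exists_branchSelection hS hB hρ r
  obtain ⟨c, hc, hyc⟩ := hsel.reachable
  have hyb : H.Reachable y b :=
    hyc.trans ((within_reachable h.preconnected hc hb).mono within_le)
  exact ⟨r, y, y', hsel, hr, hyb.trans hbr, fun w hw hyw => hmin w hw (hyb.symm.trans hyw)⟩

theorem exists_injective_mem_outerBoundary [Countable V] {ι : Type*} {B : ι → Set V} {S : Set V}
    (hS : S.Finite) (hB : ∀ i, B i ⊆ S) (hdisj : Pairwise (Function.onFun Disjoint B))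
    (hf : ∀ i, IsFurcation H (B i)) :
    ∃ f : ι → V, Function.Injective f ∧ ∀ i, f i ∈ outerBoundary H S := by
  obtain ⟨ρ, hρ⟩ := exists_injective_nat V
  choose r y y' hsel hr hyr hmin using fun i => (hf i).exists_root hS (hB i) hρ
  refine ⟨y, fun i j hij => ?_, fun i => (hsel i).mem⟩
  by_contra hne
  -- The root is determined by the cluster, hence by the selected vertex.
  have hrr : r i = r j := hρ (le_antisymm (hmin i _ (hr j) (hij ▸ hyr j))
    (hmin j _ (hr i) (hij ▸ hyr i)))
  have hSB : Disjoint (outerBoundary H S) (B i) :=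
    Set.disjoint_left.2 fun z hz hzB => hz.1 (hB i hzB)
  exact (hsel i).ne_of_disjoint hSB (hdisj hne) (hf i).preconnected (hf j).preconnected
    (hrr ▸ hsel j) (hyr i) hij

lemma exists_infinite_branch (hH : ∀ x, {y | H.Adj x y}.Finite) (hB : B.Finite) {x : V}
    (hx : x ∈ B) (hinf : {v | H.Reachable x v}.Infinite) :
    ∃ u ∉ B, H.Reachable u x ∧ {v | (within H Bᶜ).Reachable u v}.Infinite := by
  by_contra! hfin
  let N : Set V := {u | u ∉ B ∧ H.Reachable u x ∧ ∃ b ∈ B, H.Adj b u}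
  have hN : N.Finite := (hB.biUnion fun b _ => hH b).subset fun _ ⟨_, _, _, hb, hbu⟩ =>
    Set.mem_biUnion hb hbu
  refine hinf ((hB.union (hN.biUnion fun u hu => hfin u hu.1 hu.2.1)).subset fun v hxv => ?_)
  by_cases hv : v ∈ B
  · exact Or.inl hv
  · obtain ⟨u, w, hvu, huw, hw⟩ := exists_entry hx (SimpleGraph.Reachable.symm hxv) hv
    have hux : H.Reachable u x := (hvu.mono within_le).symm.trans (SimpleGraph.Reachable.symm hxv)
    exact Or.inr (Set.mem_biUnion ⟨mem_of_within_reachable hv hvu, hux, w, hw, huw.symm⟩ hvu.symm)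

lemma DistinctInfiniteClusters.cons {n : ℕ} {x : Fin n → V} (h : DistinctInfiniteClusters H x)
    {z : V} (hz : {v | H.Reachable z v}.Infinite) (hzx : ∀ i, ¬ H.Reachable z (x i)) :
    DistinctInfiniteClusters H (Fin.cons z x : Fin (n + 1) → V) where
  infinite := Fin.cases hz h.infinite
  pairwise i j hij := by
    induction i using Fin.cases with
    | zero =>
      induction j using Fin.cases with
      | zero => exact absurd rfl hij
      | succ j => exact hzx j
    | succ i =>
      induction j using Fin.cases with
      | zero => exact fun hxz => hzx i hxz.symm
      | succ j => exact h.pairwise (ne_of_apply_ne _ hij)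

lemma isFurcation_of_join (hH : ∀ x, {y | H.Adj x y}.Finite) (hB : B.Finite) (hle : H ≤ H')
    (hH' : ∀ u v, H'.Adj u v → H.Adj u v ∨ (u ∈ B ∧ v ∈ B)) (hconn : (H'.induce B).Preconnected)
    {x : Fin 3 → V} (hx : ∀ i, x i ∈ B) (hclusters : DistinctInfiniteClusters H x) :
    IsFurcation H' B := by
  have hcompl : within H' Bᶜ = within H Bᶜ := by
    ext u v
    simp only [within_adj]
    exact ⟨fun ⟨h, hu, hv⟩ => ⟨(hH' u v h).resolve_right fun hB => hu hB.1, hu, hv⟩,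
      fun ⟨h, hu, hv⟩ => ⟨hle h, hu, hv⟩⟩
  choose u huB hux hu using fun i => exists_infinite_branch hH hB (hx i) (hclusters.infinite i)
  refine ⟨hconn, x 0, hx 0, u, fun i => ⟨huB i, ?_⟩, hcompl ▸ ⟨hu, fun i j hij h => ?_⟩⟩
  · exact ((hux i).mono hle).trans ((within_reachable hconn (hx i) (hx 0)).mono within_le)
  · exact hclusters.pairwise hij (((hux i).symm.trans (h.mono within_le)).trans (hux j))

lemma exists_infinite_of_join (hB : B.Finite)
    (hH' : ∀ u v, H'.Adj u v → H.Adj u v ∨ (u ∈ B ∧ v ∈ B)) {v : V}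
    (hinf : {w | H'.Reachable v w}.Infinite) :
    ∃ w, H'.Reachable v w ∧ {z | H.Reachable w z}.Infinite := by
  by_contra! hfin
  let N : Set V := {w | w ∈ insert v B ∧ H'.Reachable v w}
  have hN : N.Finite := (hB.insert v).subset fun w hw => hw.1
  suffices h : ∀ z, H'.Reachable v z → ∃ w ∈ N, H.Reachable w z from
    hinf ((hN.biUnion fun w hw => hfin w hw.2).subset fun z hz =>
      Set.mem_iUnion₂.2 (by simpa using h z hz))
  intro z hz
  rw [SimpleGraph.reachable_iff_reflTransGen] at hz
  induction hz with
  | refl => exact ⟨v, ⟨Set.mem_insert _ _, .refl _⟩, .refl _⟩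
  | @tail a c hva hac ih =>
    rcases hH' a c hac with h | h
    · exact ih.imp fun w hw => ⟨hw.1, hw.2.trans h.reachable⟩
    · rw [← SimpleGraph.reachable_iff_reflTransGen] at hva
      exact ⟨c, ⟨Set.mem_insert_of_mem _ h.2, hva.trans hac.reachable⟩, .refl _⟩

lemma DistinctInfiniteClusters.not_of_join (hB : B.Finite) (hle : H ≤ H')
    (hH' : ∀ u v, H'.Adj u v → H.Adj u v ∨ (u ∈ B ∧ v ∈ B)) (hconn : (H'.induce B).Preconnected)
    {x : Fin 2 → V} (hx : ∀ i, x i ∈ B) (h : DistinctInfiniteClusters H x)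
    (hthree : ∀ y : Fin 3 → V, ¬ DistinctInfiniteClusters H y) (u : Fin 2 → V) :
    ¬ DistinctInfiniteClusters H' u := by
  intro hu
  have hx0 (i : Fin 2) : H'.Reachable (x i) (x 0) :=
    (within_reachable hconn (hx i) (hx 0)).mono within_le
  have hux (i : Fin 2) : H'.Reachable (u i) (x 0) := by
    obtain ⟨z, huz, hz⟩ := exists_infinite_of_join hB hH' (hu.infinite i)
    by_contra hux
    exact hthree _ (h.cons hz fun j hzx => hux ((huz.trans (hzx.mono hle)).trans (hx0 j)))
  exact hu.pairwise Fin.zero_ne_one ((hux 0).trans (hux 1).symm)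

variable {W : Type*} {K : SimpleGraph W}

/-- The isomorphism between the edges inside `B` and those inside the image of `B`. -/
def withinIso (ψ : H ≃g K) (B : Set V) :
    within H B ≃g within K (ψ '' B) where
  toEquiv := ψ.toEquiv
  map_rel_iff' {u v} := by simp [within_adj, ψ.map_adj_iff]

lemma DistinctInfiniteClusters.of_iso {ι : Type*} (ψ : H ≃g K) {x : ι → V}
    (h : DistinctInfiniteClusters H x) : DistinctInfiniteClusters K (ψ ∘ x) where
  infinite i := ((h.infinite i).image ψ.injective.injOn).mono (by
    rintro _ ⟨v, hv, rfl⟩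
    exact ψ.reachable_iff.2 hv)
  pairwise _ _ hij hr := h.pairwise hij (ψ.reachable_iff.1 hr)

lemma IsFurcation.of_iso (ψ : H ≃g K) (h : IsFurcation H B) :
    IsFurcation K (ψ '' B) := by
  obtain ⟨b, hb, u, hu, hclusters⟩ := h.branches
  refine ⟨?_, ψ b, Set.mem_image_of_mem ψ hb, ψ ∘ u,
    fun i => ⟨fun hi => (hu i).1 (ψ.injective.mem_set_image.1 hi), ψ.reachable_iff.2 (hu i).2⟩, ?_⟩
  · exact (ψ.induce ψ.injective.injOn.bijOn_image).preconnected_iff.1 h.preconnected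
  · rw [← Set.image_compl_eq ψ.bijective]
    exact hclusters.of_iso (withinIso ψ Bᶜ)

end Furcation

/-! ### Measurability of connection events -/

section Measurability

variable {V Ω : Type*} [Countable V] [MeasurableSpace Ω] {H : Ω → SimpleGraph V}

lemma exists_walk_length_succ {V : Type*} {G : SimpleGraph V} {u v : V} {n : ℕ} :
    (∃ w : G.Walk u v, w.length = n + 1) ↔ ∃ x, G.Adj u x ∧ ∃ w : G.Walk x v, w.length = n := by
  constructor
  · rintro ⟨_ | ⟨h, w⟩, hw⟩
    · simp at hw
    · exact ⟨_, h, w, by simpa using hw⟩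
  · rintro ⟨x, hx, w, hw⟩
    exact ⟨.cons hx w, by simp [hw]⟩

lemma measurable_reachable (hH : ∀ u v, Measurable fun ω => (H ω).Adj u v) (u v : V) :
    Measurable fun ω => (H ω).Reachable u v := by
  have hwalk (n : ℕ) (u : V) : Measurable fun ω => ∃ w : (H ω).Walk u v, w.length = n := by
    induction n generalizing u with
    | zero => simpa only [SimpleGraph.Walk.exists_length_eq_zero_iff] using measurable_const
    | succ n ih =>
      simp only [exists_walk_length_succ]
      exact Measurable.exists fun x => (hH u x).and (ih x)
  have hreach (ω : Ω) : (H ω).Reachable u v ↔ ∃ n, ∃ w : (H ω).Walk u v, w.length = n :=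
    ⟨fun ⟨w⟩ => ⟨_, w, rfl⟩, fun ⟨_, w, _⟩ => ⟨w⟩⟩
  simp only [hreach]
  exact Measurable.exists fun n => hwalk n u

lemma measurable_infinite {p : Ω → V → Prop} (hp : ∀ v, Measurable fun ω => p ω v) :
    Measurable fun ω => {v | p ω v}.Infinite := by
  have hinf (ω : Ω) : {v | p ω v}.Infinite ↔ ∀ F : Finset V, ∃ v, v ∉ F ∧ p ω v := by
    refine ⟨fun h F => ?_, fun h hfin => ?_⟩
    · obtain ⟨v, hv, hvF⟩ := h.exists_notMem_finset F
      exact ⟨v, hvF, hv⟩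
    · obtain ⟨v, hv, hpv⟩ := h hfin.toFinset
      exact hv (hfin.mem_toFinset.2 hpv)
  simp only [hinf]
  exact Measurable.forall fun F => Measurable.exists fun v => measurable_const.and (hp v)

lemma measurable_distinctInfiniteClusters {ι : Type*} [Countable ι]
    (hH : ∀ u v, Measurable fun ω => (H ω).Adj u v) (x : ι → V) :
    Measurable fun ω => DistinctInfiniteClusters (H ω) x := by
  have hreach := measurable_reachable hH
  have hiff (ω : Ω) : DistinctInfiniteClusters (H ω) x ↔
      (∀ i, {v | (H ω).Reachable (x i) v}.Infinite) ∧
      ∀ i j, i ≠ j → ¬ (H ω).Reachable (x i) (x j) :=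
    ⟨fun h => ⟨h.infinite, h.pairwise⟩, fun h => ⟨h.1, h.2⟩⟩
  simp only [hiff]
  exact (Measurable.forall fun i => measurable_infinite (hreach _)).and
    (Measurable.forall fun i => Measurable.forall fun j =>
      measurable_const.imp (hreach _ _).not)

lemma measurable_isFurcation (hH : ∀ u v, Measurable fun ω => (H ω).Adj u v) (B : Set V) :
    Measurable fun ω => IsFurcation (H ω) B := by
  have hwithin (u v : V) : Measurable fun ω => (within (H ω) Bᶜ).Adj u v := by
    simp only [within_adj]
    exact (hH u v).and measurable_const
  have hiff (ω : Ω) : IsFurcation (H ω) B ↔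
      (∀ x y : B, ((H ω).induce B).Reachable x y) ∧ ∃ b, b ∈ B ∧ ∃ u : Fin 3 → V,
        (∀ i, u i ∉ B ∧ (H ω).Reachable (u i) b) ∧ DistinctInfiniteClusters (within (H ω) Bᶜ) u :=
    ⟨fun h => ⟨h.preconnected, h.branches⟩, fun h => ⟨h.1, h.2⟩⟩
  simp only [hiff]
  refine (Measurable.forall fun x => Measurable.forall fun y => ?_).and
    (Measurable.exists fun b => measurable_const.and <| Measurable.exists fun u =>
      (Measurable.forall fun i => ?_).and (measurable_distinctInfiniteClusters hwithin u))
  · exact measurable_reachable (H := fun ω => (H ω).induce B) (fun u v => hH u v) x y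
  · exact measurable_const.and (measurable_reachable hH _ _)

end Measurability

/-! ### Opening bonds and translating configurations -/

section OpenBonds

variable {V W : Type*}

lemma openGraph_adj {ω : Bond V → Bool} {u v : V} :
    (openGraph ω).Adj u v ↔ ∃ h : ¬ s(u, v).IsDiag, ω ⟨s(u, v), h⟩ = true := by
  rw [openGraph, SimpleGraph.fromEdgeSet_adj]
  exact ⟨And.left, fun h => ⟨h, fun huv => h.1 (Sym2.mk_isDiag_iff.2 huv)⟩⟩

lemma measurable_openGraph_adj (u v : V) :
    Measurable fun ω : Bond V → Bool => (openGraph ω).Adj u v := by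
  simp only [openGraph_adj]
  exact Measurable.exists fun h => measurableSet_setOfPred.1
    ((measurable_pi_apply (⟨s(u, v), h⟩ : Bond V) :
      Measurable fun ω : Bond V → Bool => ω ⟨s(u, v), h⟩) (measurableSet_singleton true))

lemma openGraph_comp_congr (θ : V ≃ W) (ω : Bond W → Bool) :
    openGraph (ω ∘ Bond.congr θ) = (openGraph ω).comap θ := by
  ext u v
  simp only [SimpleGraph.comap_adj, openGraph_adj, Sym2.mk_isDiag_iff, θ.injective.eq_iff]
  rfl

/-- The translate of a function of the bonds by `a`. -/
def translateBonds {α : Type*} [AddGroup V] (a : V) (ω : Bond V → α) : Bond V → α :=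
  ω ∘ Bond.congr (Equiv.addRight a)

lemma measurable_translateBonds {α : Type*} [MeasurableSpace α] [AddGroup V] (a : V) :
    Measurable (translateBonds a : (Bond V → α) → Bond V → α) :=
  measurable_comp_congr _

/-- The isomorphism from the open graph of a translate onto the open graph. -/
def translateBondsIso [AddGroup V] (a : V) (ω : Bond V → Bool) :
    openGraph (translateBonds a ω) ≃g openGraph ω where
  toEquiv := Equiv.addRight a
  map_rel_iff' := by simp [translateBonds, openGraph_comp_congr]

variable [DecidableEq V]

/-- The configuration `ω` with the bonds of `F` opened. -/
def openBonds (F : Finset (Bond V)) (ω : Bond V → Bool) : Bond V → Bool :=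
  fun e => decide (e ∈ F) || ω e

lemma openGraph_le_openBonds (F : Finset (Bond V)) (ω : Bond V → Bool) :
    openGraph ω ≤ openGraph (openBonds F ω) := by
  intro u v h
  obtain ⟨huv, hω⟩ := openGraph_adj.1 h
  exact openGraph_adj.2 ⟨huv, by simp [openBonds, hω]⟩

lemma openGraph_openBonds_adj {F : Finset (Bond V)} {B : Finset V} (hF : F ⊆ bondsIn B)
    {ω : Bond V → Bool} {u v : V} (h : (openGraph (openBonds F ω)).Adj u v) :
    (openGraph ω).Adj u v ∨ (u ∈ (B : Set V) ∧ v ∈ (B : Set V)) := by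
  obtain ⟨huv, hω⟩ := openGraph_adj.1 h
  rcases Bool.or_eq_true_iff.1 hω with hmem | hω
  · have hB := mem_bondsIn.1 (hF (of_decide_eq_true hmem))
    exact Or.inr ⟨hB u (Sym2.mem_mk_left u v), hB v (Sym2.mem_mk_right u v)⟩
  · exact Or.inl (openGraph_adj.2 ⟨huv, hω⟩)

lemma measurable_openBonds (F : Finset (Bond V)) : Measurable (openBonds F) :=
  measurable_pi_lambda _ fun e =>
    (measurable_of_countable fun b => decide (e ∈ F) || b).comp (measurable_pi_apply e)

lemma map_openBonds_absolutelyContinuous {ν : Measure (Bond V → Bool)} (F : Finset (Bond V))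
    (hν : ∀ e ∈ F, ν.map (openBonds {e}) ≪ ν) : ν.map (openBonds F) ≪ ν := by
  induction F using Finset.induction_on with
  | empty =>
    have hid : openBonds (∅ : Finset (Bond V)) = id := by ext; simp [openBonds]
    rw [hid, Measure.map_id]
  | insert e F _ ih =>
    have hcomp : openBonds (insert e F) = openBonds {e} ∘ openBonds F := by
      ext; simp [openBonds, Bool.or_assoc]
    rw [hcomp, ← Measure.map_map (measurable_openBonds _) (measurable_openBonds F)]
    exact ((ih fun e' he' => hν e' (Finset.mem_insert_of_mem he')).map
      (measurable_openBonds _)).trans (hν e (Finset.mem_insert_self _ _))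

open scoped Classical in
/-- The bonds between vertices of `B` that are edges of `A`. -/
noncomputable def edgeBonds (A : SimpleGraph V) (B : Finset V) : Finset (Bond V) :=
  {e ∈ bondsIn B | e.1 ∈ A.edgeSet}

lemma mem_edgeBonds {A : SimpleGraph V} {B : Finset V} {e : Bond V} :
    e ∈ edgeBonds A B ↔ e ∈ bondsIn B ∧ e.1 ∈ A.edgeSet := by
  simp [edgeBonds]

lemma induce_le_openBonds (A : SimpleGraph V) (B : Finset V) (ω : Bond V → Bool) :
    A.induce (B : Set V) ≤ (openGraph (openBonds (edgeBonds A B) ω)).induce (B : Set V) := by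
  intro u v huv
  have hdiag : ¬ s(u.1, v.1).IsDiag := fun h => huv.ne (Subtype.ext (Sym2.mk_isDiag_iff.1 h))
  have hmem : ⟨s(u.1, v.1), hdiag⟩ ∈ edgeBonds A B := mem_edgeBonds.2
    ⟨mem_bondsIn.2 (by simp), huv⟩
  exact openGraph_adj.2 ⟨hdiag, by simp [openBonds, hmem]⟩

end OpenBonds

/-! ### Furcations in translation-invariant percolation -/

section Counting

lemma tsum_measure_le_tsum_measure {Ω ι κ : Type*} [MeasurableSpace Ω] [Countable ι] [Countable κ]
    {ν : Measure Ω} {A : ι → Set Ω} {C : κ → Set Ω} (hA : ∀ i, MeasurableSet (A i))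
    (hC : ∀ k, MeasurableSet (C k))
    (h : ∀ ω, ∃ f : {i | ω ∈ A i} → κ, Function.Injective f ∧ ∀ i, ω ∈ C (f i)) :
    ∑' i, ν (A i) ≤ ∑' k, ν (C k) := by
  have hcount (ω : Ω) :
      ∑' i, (A i).indicator (1 : Ω → ℝ≥0∞) ω ≤ ∑' k, (C k).indicator (1 : Ω → ℝ≥0∞) ω := by
    obtain ⟨f, hf, hfC⟩ := h ω
    calc ∑' i, (A i).indicator (1 : Ω → ℝ≥0∞) ω
        = ∑' _ : {i | ω ∈ A i}, 1 := (tsum_subtype {i | ω ∈ A i} 1).symm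
      _ = ∑' i, (C (f i)).indicator (1 : Ω → ℝ≥0∞) ω := by simp [hfC]
      _ ≤ _ := ENNReal.tsum_comp_le_tsum_of_injective hf _
  calc ∑' i, ν (A i) = ∫⁻ ω, ∑' i, (A i).indicator (1 : Ω → ℝ≥0∞) ω ∂ν := by
        rw [lintegral_tsum fun i => (measurable_one.indicator (hA i)).aemeasurable]
        simp only [lintegral_indicator_one (hA _)]
    _ ≤ ∫⁻ ω, ∑' k, (C k).indicator (1 : Ω → ℝ≥0∞) ω ∂ν := lintegral_mono hcount
    _ = ∑' k, ν (C k) := by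
        rw [lintegral_tsum fun k => (measurable_one.indicator (hC k)).aemeasurable]
        simp only [lintegral_indicator_one (hC _)]

lemma measurable_mem_outerBoundary {V : Type*} [Countable V] (S : Set V) (y : V) :
    Measurable fun ω : Bond V → Bool => y ∈ outerBoundary (openGraph ω) S :=
  measurable_const.and <| Measurable.exists fun x =>
    measurable_const.and (measurable_openGraph_adj x y)

lemma tsum_measure_isFurcation_le {V ι : Type*} [Countable V] [Countable ι]
    (ν : Measure (Bond V → Bool)) {B : ι → Set V} {S : Set V} (hS : S.Finite)
    (hB : ∀ i, B i ⊆ S) (hdisj : Pairwise (Function.onFun Disjoint B)) :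
    ∑' i, ν {ω | IsFurcation (openGraph ω) (B i)} ≤
      ∑' y, ν {ω | y ∈ outerBoundary (openGraph ω) S} :=
  tsum_measure_le_tsum_measure
    (fun i => measurableSet_setOfPred.2 (measurable_isFurcation measurable_openGraph_adj (B i)))
    (fun y => measurableSet_setOfPred.2 (measurable_mem_outerBoundary S y))
    fun _ => exists_injective_mem_outerBoundary hS (fun i => hB i)
      (fun _ _ hij => hdisj (Subtype.coe_injective.ne hij)) fun i => i.2

variable {V : Type*} [AddCommGroup V] [DecidableEq V]

/-- The number of vertices of `S` that are moved out of `S` by the translation by `z`. -/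
def exitCount (S : Finset V) (z : V) : ℕ := {x ∈ S | x + z ∉ S}.card

lemma tsum_measure_outerBoundary_le {ν : Measure (Bond V → Bool)} {p : V → ℝ≥0∞}
    (hνp : ∀ x y, ν {ω | (openGraph ω).Adj x y} ≤ p (y - x)) (S : Finset V) :
    ∑' y, ν {ω | y ∈ outerBoundary (openGraph ω) S} ≤ ∑' z, p z * exitCount S z := by
  have hunion (y : V) : ν {ω | y ∈ outerBoundary (openGraph ω) S} ≤
      ∑ x ∈ S, if y ∉ S then p (y - x) else 0 := by
    by_cases hy : y ∈ S
    · simp [outerBoundary, hy]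
    · have hset : {ω | y ∈ outerBoundary (openGraph ω) S} =
          ⋃ x ∈ S, {ω | (openGraph ω).Adj x y} := by
        ext; simp [outerBoundary, hy]
      simp only [hset, hy, not_false_eq_true, if_true]
      exact (measure_biUnion_finset_le S _).trans (Finset.sum_le_sum fun x _ => hνp x y)
  calc ∑' y, ν {ω | y ∈ outerBoundary (openGraph ω) S}
      ≤ ∑' y, ∑ x ∈ S, if y ∉ S then p (y - x) else 0 := ENNReal.tsum_le_tsum hunion
    _ = ∑ x ∈ S, ∑' y, if y ∉ S then p (y - x) else 0 :=
        Summable.tsum_finsetSum fun _ _ => ENNReal.summable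
    _ = ∑ x ∈ S, ∑' z, if x + z ∉ S then p z else 0 := by
        refine Finset.sum_congr rfl fun x _ => ?_
        rw [← (Equiv.addLeft x).tsum_eq]
        simp
    _ = ∑' z, ∑ x ∈ S, if x + z ∉ S then p z else 0 :=
        (Summable.tsum_finsetSum fun _ _ => ENNReal.summable).symm
    _ = ∑' z, p z * exitCount S z := by
        refine tsum_congr fun z => ?_
        rw [← Finset.sum_filter, Finset.sum_const, nsmul_eq_mul, mul_comm, exitCount]

end Counting

section CornerBox

variable {d : ℕ}

/-- The box `[0, n)^d`. -/
noncomputable def cornerBox (d n : ℕ) : Finset (Fin d → ℤ) :=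
  Fintype.piFinset fun _ => Finset.Ico 0 (n : ℤ)

lemma mem_cornerBox {n : ℕ} {x : Fin d → ℤ} : x ∈ cornerBox d n ↔ ∀ i, 0 ≤ x i ∧ x i < n := by
  simp [cornerBox]

lemma card_cornerBox (d n : ℕ) : (cornerBox d n).card = n ^ d := by
  simp [cornerBox]

lemma exitCount_cornerBox_mul_le (n : ℕ) (z : Fin d → ℤ) :
    exitCount (cornerBox d n) z * n ≤ (∑ i, (z i).natAbs) * n ^ d := by
  let slab (i : Fin d) : Finset (Fin d → ℤ) := Fintype.piFinset
    (Function.update (fun _ => Finset.Ico 0 (n : ℤ)) i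
      (Finset.Ico 0 (-z i) ∪ Finset.Ico (n - z i) n))
  have hslab (i : Fin d) : (slab i).card * n ≤ (z i).natAbs * n ^ d := by
    have hside : (Finset.Ico 0 (-z i) ∪ Finset.Ico (n - z i) n).card ≤ (z i).natAbs := by
      refine (Finset.card_union_le _ _).trans ?_
      simp only [Int.card_Ico]
      omega
    have hprod : ∏ j ∈ Finset.univ \ {i}, (Finset.Ico 0 (n : ℤ)).card = n ^ (d - 1) := by
      simp [Finset.card_sdiff_of_subset]
    simp only [slab, Fintype.card_piFinset, Function.apply_update fun _ => Finset.card]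
    rw [Finset.prod_update_of_mem (Finset.mem_univ i), hprod, mul_assoc,
      pow_sub_one_mul (Nat.ne_zero_of_lt i.2)]
    exact Nat.mul_le_mul_right _ hside
  have hcover : {x ∈ cornerBox d n | x + z ∉ cornerBox d n} ⊆ Finset.univ.biUnion slab := by
    intro x hx
    obtain ⟨hxn, hxz⟩ := Finset.mem_filter.1 hx
    rw [mem_cornerBox] at hxn hxz
    obtain ⟨i, hi⟩ := not_forall.1 hxz
    refine Finset.mem_biUnion.2 ⟨i, Finset.mem_univ i, Fintype.mem_piFinset.2 fun j => ?_⟩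
    obtain rfl | hji := eq_or_ne j i
    · have := hxn j
      simp only [Pi.add_apply] at hi
      simp only [Function.update_self, Finset.mem_union, Finset.mem_Ico]
      omega
    · simpa [Function.update_of_ne hji] using hxn j
  calc exitCount (cornerBox d n) z * n ≤ (∑ i, (slab i).card) * n :=
        Nat.mul_le_mul_right _ ((Finset.card_le_card hcover).trans Finset.card_biUnion_le)
    _ = ∑ i, (slab i).card * n := Finset.sum_mul ..
    _ ≤ ∑ i, (z i).natAbs * n ^ d := Finset.sum_le_sum fun i _ => hslab i
    _ = _ := (Finset.sum_mul ..).symm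

lemma tendsto_exitCount_cornerBox_div (z : Fin d → ℤ) :
    Tendsto (fun n => (exitCount (cornerBox d n) z : ℝ≥0∞) / (n : ℝ≥0∞) ^ d) atTop (𝓝 0) := by
  have hlim := ENNReal.Tendsto.const_mul (a := ((∑ i, (z i).natAbs : ℕ) : ℝ≥0∞))
    ENNReal.tendsto_inv_nat_nhds_zero (Or.inr (ENNReal.natCast_ne_top _))
  rw [mul_zero] at hlim
  refine tendsto_of_tendsto_of_tendsto_of_le_of_le' tendsto_const_nhds hlim
    (Eventually.of_forall fun _ => zero_le) ?_
  filter_upwards [eventually_ne_atTop 0] with n hn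
  have hn0 : (n : ℝ≥0∞) ≠ 0 := Nat.cast_ne_zero.2 hn
  rw [ENNReal.div_le_iff (pow_ne_zero d hn0) (ENNReal.pow_ne_top (ENNReal.natCast_ne_top n)),
    mul_right_comm, ← div_eq_mul_inv,
    ENNReal.le_div_iff_mul_le (Or.inl hn0) (Or.inl (ENNReal.natCast_ne_top n))]
  exact_mod_cast exitCount_cornerBox_mul_le n z

lemma tendsto_tsum_mul_exitCount_cornerBox_div {p : (Fin d → ℤ) → ℝ≥0∞} (hp : ∑' z, p z ≠ ∞) :
    Tendsto (fun n : ℕ => (∑' z, p z * exitCount (cornerBox d n) z) / (n : ℝ≥0∞) ^ d)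
      atTop (𝓝 0) := by
  have hle (n : ℕ) (z : Fin d → ℤ) :
      (exitCount (cornerBox d n) z : ℝ≥0∞) / (n : ℝ≥0∞) ^ d ≤ 1 := by
    refine ENNReal.div_le_of_le_mul ?_
    rw [one_mul]
    exact_mod_cast (Finset.card_filter_le _ _).trans (card_cornerBox d n).le
  have hlim := tendsto_lintegral_of_dominated_convergence (μ := Measure.count)
    (F := fun n z => p z * ((exitCount (cornerBox d n) z : ℝ≥0∞) / (n : ℝ≥0∞) ^ d))
    (f := 0) p (fun n => measurable_of_countable _)
    (fun n => Eventually.of_forall fun z => mul_le_of_le_one_right' (hle n z))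
    (by rwa [lintegral_count])
    (Eventually.of_forall fun z => by
      simpa using ENNReal.Tendsto.const_mul (tendsto_exitCount_cornerBox_div z)
        (Or.inr (ENNReal.ne_top_of_tsum_ne_top hp z)))
  simpa [lintegral_count, div_eq_mul_inv, ← mul_assoc, ENNReal.tsum_mul_right] using hlim

lemma add_smul_mem_cornerBox {s L : ℕ} {x t : Fin d → ℤ} (hx : x ∈ cornerBox d s)
    (ht : t ∈ cornerBox d L) : x + s • t ∈ cornerBox d (s * L) := by
  rw [mem_cornerBox] at *
  intro i
  obtain ⟨hx0, hxs⟩ := hx i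
  obtain ⟨ht0, htL⟩ := ht i
  simp only [Pi.add_apply, nsmul_eq_mul, Pi.mul_apply, Pi.natCast_apply, Nat.cast_mul]
  constructor
  · positivity
  · nlinarith

lemma eq_of_add_smul_eq_add_smul {s : ℕ} {x y t u : Fin d → ℤ} (hx : x ∈ cornerBox d s)
    (hy : y ∈ cornerBox d s) (h : x + s • t = y + s • u) : t = u := by
  funext i
  have hdiv {w v : Fin d → ℤ} (hw : w ∈ cornerBox d s) : (w + s • v) i / s = v i := by
    obtain ⟨hw0, hws⟩ := mem_cornerBox.1 hw i
    simp only [Pi.add_apply, nsmul_eq_mul, Pi.mul_apply, Pi.natCast_apply]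
    rw [Int.add_mul_ediv_left _ _ (by omega), Int.ediv_eq_zero_of_lt hw0 hws, zero_add]
  rw [← hdiv (v := t) hx, h, hdiv hy]

lemma exists_translate_subset_cornerBox (B : Finset (Fin d → ℤ)) :
    ∃ a, ∃ s ≠ 0, ∀ x ∈ B, x + a ∈ cornerBox d s := by
  obtain ⟨m, hm⟩ := ((tendsto_latticeBox d).eventually_ge_atTop B).exists
  refine ⟨fun _ => m, 2 * m + 1, by omega, fun x hx => mem_cornerBox.2 fun i => ?_⟩
  obtain ⟨hlower, hupper⟩ := Finset.mem_Icc.1 (hm hx)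
  have hi := And.intro (hlower i) (hupper i)
  simp only [Pi.add_apply] at hi ⊢
  omega

end CornerBox

section NoFurcation

lemma measure_isFurcation_le_translate {V : Type*} [AddGroup V] [Countable V]
    {ν : Measure (Bond V → Bool)} {a : V} (hshift : ν.map (translateBonds a) = ν) (B : Set V) :
    ν {ω | IsFurcation (openGraph ω) B} ≤
      ν {ω | IsFurcation (openGraph ω) (Equiv.addRight a '' B)} := by
  conv_lhs => rw [← hshift]
  rw [Measure.map_apply (measurable_translateBonds a) (measurableSet_setOfPred.2
    (measurable_isFurcation measurable_openGraph_adj B))]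
  exact measure_mono fun ω hω => hω.of_iso (translateBondsIso a ω)

variable {d : ℕ} {ν : Measure (Bond (Fin d → ℤ) → Bool)} {p : (Fin d → ℤ) → ℝ≥0∞}

/-- The box `[0, s L)^d` contains `L^d` disjoint translates of `B`. -/
lemma measure_isFurcation_mul_le (hshift : ∀ a, ν.map (translateBonds a) = ν)
    (hνp : ∀ x y, ν {ω | (openGraph ω).Adj x y} ≤ p (y - x)) {B : Set (Fin d → ℤ)} {s : ℕ}
    (hB : B ⊆ cornerBox d s) (L : ℕ) :
    ν {ω | IsFurcation (openGraph ω) B} * (L : ℝ≥0∞) ^ d ≤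
      ∑' z, p z * exitCount (cornerBox d (s * L)) z := by
  let block (t : cornerBox d L) : Set (Fin d → ℤ) := Equiv.addRight (s • t.1) '' B
  have hblock (t : cornerBox d L) : block t ⊆ cornerBox d (s * L) := by
    rintro _ ⟨x, hx, rfl⟩
    exact add_smul_mem_cornerBox (hB hx) t.2
  have hdisj : Pairwise (Function.onFun Disjoint block) := by
    intro t u htu
    refine Set.disjoint_left.2 ?_
    rintro _ ⟨x, hx, rfl⟩ ⟨y, hy, hxy⟩
    exact htu (Subtype.ext (eq_of_add_smul_eq_add_smul (hB hx) (hB hy) hxy.symm))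
  calc ν {ω | IsFurcation (openGraph ω) B} * (L : ℝ≥0∞) ^ d
      = ∑' _ : cornerBox d L, ν {ω | IsFurcation (openGraph ω) B} := by
        simp [card_cornerBox, mul_comm]
    _ ≤ ∑' t, ν {ω | IsFurcation (openGraph ω) (block t)} :=
        ENNReal.tsum_le_tsum fun t => measure_isFurcation_le_translate (hshift _) B
    _ ≤ ∑' y, ν {ω | y ∈ outerBoundary (openGraph ω) (cornerBox d (s * L))} :=
        tsum_measure_isFurcation_le ν (Finset.finite_toSet _) hblock hdisj
    _ ≤ _ := tsum_measure_outerBoundary_le hνp _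

theorem measure_isFurcation_eq_zero (hshift : ∀ a, ν.map (translateBonds a) = ν)
    (hp : ∑' z, p z ≠ ∞) (hνp : ∀ x y, ν {ω | (openGraph ω).Adj x y} ≤ p (y - x))
    (B : Finset (Fin d → ℤ)) : ν {ω | IsFurcation (openGraph ω) B} = 0 := by
  obtain ⟨a, s, hs, hB⟩ := exists_translate_subset_cornerBox B
  suffices h : ν {ω | IsFurcation (openGraph ω) (Equiv.addRight a '' (B : Set _))} = 0 from
    le_antisymm ((measure_isFurcation_le_translate (hshift a) _).trans_eq h) zero_le
  have hB' : Equiv.addRight a '' (B : Set (Fin d → ℤ)) ⊆ cornerBox d s := by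
    rintro _ ⟨x, hx, rfl⟩
    exact hB x hx
  set q := ν {ω | IsFurcation (openGraph ω) (Equiv.addRight a '' (B : Set (Fin d → ℤ)))}
  have hlim := (tendsto_tsum_mul_exitCount_cornerBox_div hp).comp
    (tendsto_id.const_mul_atTop' (Nat.pos_of_ne_zero hs))
  have hle : q / (s : ℝ≥0∞) ^ d ≤ 0 := by
    refine ge_of_tendsto hlim ?_
    filter_upwards [eventually_ne_atTop 0] with L hL
    have hL0 : (L : ℝ≥0∞) ^ d ≠ 0 := pow_ne_zero _ (Nat.cast_ne_zero.2 hL)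
    calc q / (s : ℝ≥0∞) ^ d = q * (L : ℝ≥0∞) ^ d / ((s * L : ℕ) : ℝ≥0∞) ^ d := by
          rw [Nat.cast_mul, mul_pow, ENNReal.mul_div_mul_right _ _ hL0
            (ENNReal.pow_ne_top (ENNReal.natCast_ne_top L))]
      _ ≤ _ := ENNReal.div_le_div_right (measure_isFurcation_mul_le hshift hνp hB' L) _
  exact (ENNReal.div_eq_zero_iff.1 (nonpos_iff_eq_zero.1 hle)).resolve_right
    (ENNReal.pow_ne_top (ENNReal.natCast_ne_top s))

end NoFurcation

/-! ### Uniqueness of the infinite cluster -/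

section LocalModification

lemma exists_measurableCylinders_symmDiff_lt {ι : Type*} {X : ι → Type*}
    [∀ i, MeasurableSpace (X i)] (μ : Measure (∀ i, X i)) [IsFiniteMeasure μ]
    {I : Set (∀ i, X i)} (hI : MeasurableSet I) {ε : ℝ≥0∞} (hε : 0 < ε) :
    ∃ C ∈ measurableCylinders X, μ (symmDiff C I) < ε :=
  exists_measure_symmDiff_lt_of_generateFrom_isSetRing isSetRing_measurableCylinders
    ⟨{Set.univ}, Set.countable_singleton _,
      Set.singleton_subset_iff.2 (univ_mem_measurableCylinders X), by simp⟩
    generateFrom_measurableCylinders.symm hI hε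

variable {V : Type*} [AddGroup V]

lemma exists_congr_addRight_notMem [Infinite V] (E F : Finset (Bond V)) :
    ∃ a : V, ∀ e ∈ E, Bond.congr (Equiv.addRight a) e ∉ F := by
  have hfin (e f : Bond V) : {a : V | Bond.congr (Equiv.addRight a) e = f}.Finite := by
    obtain ⟨⟨u, u'⟩, -⟩ := e
    obtain ⟨⟨v, v'⟩, -⟩ := f
    refine (Set.toFinite {-u + v, -u + v'}).subset fun a ha => ?_
    have huv : s(u + a, u' + a) = s(v, v') := congrArg Subtype.val ha
    have hu : u + a ∈ s(v, v') := huv ▸ Sym2.mem_mk_left _ _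
    simpa [eq_neg_add_iff_add_eq] using hu
  obtain ⟨a, ha⟩ := (E.finite_toSet.biUnion fun e _ =>
    F.finite_toSet.biUnion fun f _ => hfin e f).exists_notMem
  exact ⟨a, fun e he hF => ha (Set.mem_biUnion he
    (Set.mem_biUnion (t := fun f => {a | Bond.congr (Equiv.addRight a) e = f}) hF rfl))⟩

variable {α : Type*} [MeasurableSpace α] {T : (Bond V → α) → Bond V → α} {F : Finset (Bond V)}

lemma exists_forall_translateBonds_mem_iff [Infinite V] (hTF : ∀ ω, ∀ e ∉ F, T ω e = ω e)
    {C : Set (Bond V → α)} (hC : C ∈ measurableCylinders fun _ : Bond V => α) :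
    ∃ a, ∀ ω, translateBonds a (T ω) ∈ C ↔ translateBonds a ω ∈ C := by
  obtain ⟨E, S, -, rfl⟩ := (mem_measurableCylinders C).1 hC
  obtain ⟨a, ha⟩ := exists_congr_addRight_notMem E F
  refine ⟨a, fun ω => ?_⟩
  have hrestrict : E.restrict (translateBonds a (T ω)) = E.restrict (translateBonds a ω) :=
    funext fun e => hTF ω _ (ha e e.2)
  rw [mem_cylinder, mem_cylinder, hrestrict]

-- A translation-invariant event is approximated by cylinder events, which may be translated so
-- that they do not depend on the coordinates in `F`.
lemma ae_mem_iff_of_forall_translateBonds [Infinite V] {ν : Measure (Bond V → α)}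
    [IsFiniteMeasure ν] (hshift : ∀ a, ν.map (translateBonds a) = ν) (hT : Measurable T)
    (hTF : ∀ ω, ∀ e ∉ F, T ω e = ω e) (hac : ν.map T ≪ ν) {I : Set (Bond V → α)}
    (hI : MeasurableSet I) (hinv : ∀ a ω, translateBonds a ω ∈ I ↔ ω ∈ I) :
    ∀ᵐ ω ∂ν, T ω ∈ I ↔ ω ∈ I := by
  have hε (n : ℕ) : (0 : ℝ≥0∞) < 2⁻¹ ^ n := ENNReal.pow_pos (by simp) n
  choose C hC hCI using fun n => exists_measurableCylinders_symmDiff_lt ν hI (hε n)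
  choose a ha using fun n => exists_forall_translateBonds_mem_iff hTF (hC n)
  have hsum : ∑' n, ν (translateBonds (a n) ⁻¹' symmDiff (C n) I) ≠ ∞ := by
    have hle (n : ℕ) : ν (translateBonds (a n) ⁻¹' symmDiff (C n) I) ≤ 2⁻¹ ^ n := by
      rw [← Measure.map_apply (measurable_translateBonds _)
        ((MeasurableSet.of_mem_measurableCylinders (hC n)).symmDiff hI), hshift]
      exact (hCI n).le
    exact ne_top_of_le_ne_top (by simp [ENNReal.tsum_geometric]) (ENNReal.tsum_le_tsum hle)
  have hgood : ∀ᵐ ω ∂ν, ∀ᶠ n in atTop, translateBonds (a n) ω ∈ C n ↔ ω ∈ I := by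
    filter_upwards [ae_eventually_notMem hsum] with ω hω
    filter_upwards [hω] with n hn
    rw [Set.mem_preimage, Set.mem_symmDiff, hinv] at hn
    tauto
  filter_upwards [hgood, ae_of_ae_map hT.aemeasurable (hac.ae_le hgood)] with ω hω hTω
  obtain ⟨n, hn, hTn⟩ := (hω.and hTω).exists
  rw [← hn, ← hTn, ha]

end LocalModification

section Uniqueness

lemma atMostOneInfiniteCluster_iff {V : Type*} {ω : Bond V → Bool} :
    AtMostOneInfiniteCluster ω ↔ ∀ x : Fin 2 → V, ¬ DistinctInfiniteClusters (openGraph ω) x := by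
  have hsupp (v : V) : ((openGraph ω).connectedComponentMk v).supp =
      {w | (openGraph ω).Reachable v w} :=
    Set.ext fun w => SimpleGraph.ConnectedComponent.eq.trans SimpleGraph.reachable_comm
  refine ⟨fun h x hx => ?_, fun h C C' hC hC' => ?_⟩
  · refine hx.pairwise Fin.zero_ne_one (SimpleGraph.ConnectedComponent.eq.1 (h _ _ ?_ ?_)) <;>
    · rw [hsupp]
      exact hx.infinite _
  · induction C using SimpleGraph.ConnectedComponent.ind with | _ v
    induction C' using SimpleGraph.ConnectedComponent.ind with | _ w
    rw [hsupp] at hC hC'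
    by_contra hne
    have hvw : ¬ (openGraph ω).Reachable v w := fun h =>
      hne (SimpleGraph.ConnectedComponent.eq.2 h)
    refine h ![v, w] ⟨fun i => ?_, fun i j hij => ?_⟩
    · fin_cases i
      exacts [hC, hC']
    · fin_cases i <;> fin_cases j
      exacts [absurd rfl hij, hvw, fun h => hvw h.symm, absurd rfl hij]

lemma ae_finite_adj {V : Type*} [AddGroup V] [Countable V] {ν : Measure (Bond V → Bool)}
    {p : V → ℝ≥0∞} (hp : ∑' z, p z ≠ ∞)
    (hνp : ∀ x y, ν {ω | (openGraph ω).Adj x y} ≤ p (y - x)) :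
    ∀ᵐ ω ∂ν, ∀ x, {y | (openGraph ω).Adj x y}.Finite := by
  refine ae_all_iff.2 fun x =>
    ae_finite_setOfPred_mem (s := fun y => {ω | (openGraph ω).Adj x y}) ?_
  exact ne_top_of_le_ne_top (((Equiv.subRight x).tsum_eq p).trans_ne hp)
    (ENNReal.tsum_le_tsum fun y => hνp x y)

lemma exists_openBonds_connecting {V : Type*} [DecidableEq V] {ν : Measure (Bond V → Bool)}
    {A : SimpleGraph V} (hA : A.Preconnected)
    (hins : ∀ e : Bond V, e.1 ∈ A.edgeSet → ν.map (openBonds {e}) ≪ ν) {n : ℕ}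
    (x : Fin (n + 1) → V) :
    ∃ B : Finset V, (∀ i, x i ∈ B) ∧ ∃ F ⊆ bondsIn B, ν.map (openBonds F) ≪ ν ∧
      ∀ ω, ((openGraph (openBonds F ω)).induce (B : Set V)).Preconnected := by
  obtain ⟨B, hxB, hB⟩ := SimpleGraph.extend_finset_to_connected hA
    (Finset.univ_nonempty.image x)
  refine ⟨B, fun i => hxB (Finset.mem_image_of_mem x (Finset.mem_univ i)), edgeBonds A B,
    fun e he => (mem_edgeBonds.1 he).1, ?_, fun ω => ?_⟩
  · exact map_openBonds_absolutelyContinuous _ fun e he => hins e (mem_edgeBonds.1 he).2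
  · exact hB.preconnected.mono (induce_le_openBonds A B ω)

variable {d : ℕ} {ν : Measure (Bond (Fin d → ℤ) → Bool)} {p : (Fin d → ℤ) → ℝ≥0∞}
  {A : SimpleGraph (Fin d → ℤ)}

lemma ae_not_three_infinite_clusters (hshift : ∀ a, ν.map (translateBonds a) = ν)
    (hp : ∑' z, p z ≠ ∞) (hνp : ∀ x y, ν {ω | (openGraph ω).Adj x y} ≤ p (y - x))
    (hA : A.Preconnected)
    (hins : ∀ e : Bond (Fin d → ℤ), e.1 ∈ A.edgeSet → ν.map (openBonds {e}) ≪ ν) :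
    ∀ᵐ ω ∂ν, ∀ x : Fin 3 → Fin d → ℤ, ¬ DistinctInfiniteClusters (openGraph ω) x := by
  refine ae_all_iff.2 fun x => ?_
  obtain ⟨B, hxB, F, hFB, hac, hconn⟩ := exists_openBonds_connecting hA hins x
  have hfurc : ∀ᵐ ω ∂ν, ¬ IsFurcation (openGraph ω) (B : Set (Fin d → ℤ)) := by
    simpa [ae_iff] using measure_isFurcation_eq_zero hshift hp hνp B
  filter_upwards [ae_finite_adj hp hνp,
    ae_of_ae_map (measurable_openBonds F).aemeasurable (hac.ae_le hfurc)] with ω hfin hω hx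
  exact hω (isFurcation_of_join hfin B.finite_toSet (openGraph_le_openBonds F ω)
    (fun _ _ => openGraph_openBonds_adj hFB) (hconn ω) hxB hx)

/-- The event that there are two infinite clusters. -/
def twoInfiniteClusters (V : Type*) : Set (Bond V → Bool) :=
  {ω | ∃ x : Fin 2 → V, DistinctInfiniteClusters (openGraph ω) x}

lemma measurableSet_twoInfiniteClusters (V : Type*) [Countable V] :
    MeasurableSet (twoInfiniteClusters V) :=
  measurableSet_setOfPred.2 <| Measurable.exists fun x =>
    measurable_distinctInfiniteClusters measurable_openGraph_adj x

lemma translateBonds_mem_twoInfiniteClusters {V : Type*} [AddGroup V] {a : V}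
    {ω : Bond V → Bool} : translateBonds a ω ∈ twoInfiniteClusters V ↔ ω ∈ twoInfiniteClusters V :=
  ⟨fun ⟨_, hx⟩ => ⟨_, hx.of_iso (translateBondsIso a ω)⟩,
    fun ⟨_, hx⟩ => ⟨_, hx.of_iso (translateBondsIso a ω).symm⟩⟩

theorem ae_atMostOneInfiniteCluster [IsFiniteMeasure ν]
    (hshift : ∀ a, ν.map (translateBonds a) = ν)
    (hp : ∑' z, p z ≠ ∞) (hνp : ∀ x y, ν {ω | (openGraph ω).Adj x y} ≤ p (y - x))
    (hA : A.Preconnected)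
    (hins : ∀ e : Bond (Fin d → ℤ), e.1 ∈ A.edgeSet → ν.map (openBonds {e}) ≪ ν) :
    ∀ᵐ ω ∂ν, AtMostOneInfiniteCluster ω := by
  rcases finite_or_infinite (Fin d → ℤ) with _ | _
  · exact Eventually.of_forall fun ω C _ hC => absurd (Set.toFinite C.supp) hC
  simp only [atMostOneInfiniteCluster_iff]
  refine ae_all_iff.2 fun x => ?_
  obtain ⟨B, hxB, F, hFB, hac, hconn⟩ := exists_openBonds_connecting hA hins x
  have hopen : ∀ᵐ ω ∂ν, openBonds F ω ∈ twoInfiniteClusters _ ↔ ω ∈ twoInfiniteClusters _ :=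
    ae_mem_iff_of_forall_translateBonds (F := F) hshift (measurable_openBonds F)
      (fun ω e he => by simp [openBonds, he]) hac (measurableSet_twoInfiniteClusters _)
      fun _ _ => translateBonds_mem_twoInfiniteClusters
  filter_upwards [hopen, ae_not_three_infinite_clusters hshift hp hνp hA hins]
    with ω hω hthree hx
  obtain ⟨u, hu⟩ := hω.2 ⟨x, hx⟩
  exact hx.not_of_join B.finite_toSet (openGraph_le_openBonds F ω)
    (fun _ _ => openGraph_openBonds_adj hFB) (hconn ω) hxB hthree u hu

end Uniqueness

/-! ### The trace of the sum of two independent currents -/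

section SumTrace

variable {V : Type*} {P Q : Measure (Current V)}

lemma measurable_trace_add :
    Measurable fun p : Current V × Current V => Current.trace (p.1 + p.2) := by
  refine measurable_pi_lambda _ fun e => ?_
  have hadd : Measurable fun p : Current V × Current V => p.1 e + p.2 e :=
    ((measurable_pi_apply e).comp measurable_fst).add ((measurable_pi_apply e).comp measurable_snd)
  exact (measurable_of_countable fun m : ℕ => decide (0 < m)).comp hadd

lemma isProbabilityMeasure_sumTraceLaw [IsProbabilityMeasure P] [IsProbabilityMeasure Q] :
    IsProbabilityMeasure (sumTraceLaw P Q) :=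
  Measure.isProbabilityMeasure_map measurable_trace_add.aemeasurable

lemma sumTraceLaw_map_comp_congr [SFinite P] [SFinite Q] {θ : V ≃ V}
    (hP : P.map (fun n => n ∘ Bond.congr θ) = P) (hQ : Q.map (fun n => n ∘ Bond.congr θ) = Q) :
    (sumTraceLaw P Q).map (fun ω => ω ∘ Bond.congr θ) = sumTraceLaw P Q := by
  have hm : Measurable fun n : Current V => n ∘ Bond.congr θ := measurable_comp_congr θ
  conv_rhs => rw [sumTraceLaw, ← hP, ← hQ, Measure.map_prod_map _ _ hm hm,
    Measure.map_map measurable_trace_add (hm.prodMap hm)]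
  rw [sumTraceLaw, Measure.map_map (measurable_comp_congr θ) measurable_trace_add]
  rfl

lemma Current.trace_add_two_add [DecidableEq V] (e : Bond V) (n m : Current V) :
    Current.trace (n + Pi.single e 2 + m) = openBonds {e} (Current.trace (n + m)) := by
  ext e'
  rcases eq_or_ne e' e with rfl | he
  · simp [openBonds, Current.trace]
  · simp [openBonds, Current.trace, he]

lemma sumTraceLaw_map_openBonds_absolutelyContinuous [DecidableEq V] [SFinite P] [SFinite Q]
    {e : Bond V} (hP : P.map (fun n => n + Pi.single e 2) ≪ P) :
    (sumTraceLaw P Q).map (openBonds {e}) ≪ sumTraceLaw P Q := by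
  have hm := measurable_add_two e
  have hcomp : openBonds {e} ∘ (fun p : Current V × Current V => Current.trace (p.1 + p.2)) =
      (fun p => Current.trace (p.1 + p.2)) ∘ Prod.map (fun n => n + Pi.single e 2) id :=
    funext fun p => (Current.trace_add_two_add e p.1 p.2).symm
  rw [sumTraceLaw, Measure.map_map (measurable_openBonds {e}) measurable_trace_add, hcomp,
    ← Measure.map_map measurable_trace_add (hm.prodMap measurable_id),
    ← Measure.map_prod_map _ _ hm measurable_id, Measure.map_id]
  exact (hP.prod Measure.AbsolutelyContinuous.rfl).map measurable_trace_add

lemma sumTraceLaw_open_le [IsProbabilityMeasure P] [IsProbabilityMeasure Q] (e : Bond V) :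
    sumTraceLaw P Q {ω | ω e = true} ≤ P {n | n e ≠ 0} + Q {n | n e ≠ 0} := by
  have hs : MeasurableSet {ω : Bond V → Bool | ω e = true} :=
    (measurable_pi_apply e : Measurable fun ω : Bond V → Bool => ω e) (measurableSet_singleton true)
  have hsub : (fun p : Current V × Current V => Current.trace (p.1 + p.2)) ⁻¹' {ω | ω e = true} ⊆
      {n | n e ≠ 0} ×ˢ Set.univ ∪ Set.univ ×ˢ {n | n e ≠ 0} := by
    intro p hp
    have hpos : 0 < p.1 e + p.2 e := of_decide_eq_true hp
    have hne : p.1 e ≠ 0 ∨ p.2 e ≠ 0 := by omega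
    simpa using hne
  rw [sumTraceLaw, Measure.map_apply measurable_trace_add hs]
  refine (measure_mono hsub).trans ((measure_union_le _ _).trans ?_)
  simp [Measure.prod_prod]

lemma sumTraceLaw_adj_le [IsProbabilityMeasure P] [IsProbabilityMeasure Q] {f g : Sym2 V → ℝ≥0∞}
    (hP : ∀ e : Bond V, P {n | n e ≠ 0} ≤ f e.1) (hQ : ∀ e : Bond V, Q {n | n e ≠ 0} ≤ g e.1)
    (x y : V) : sumTraceLaw P Q {ω | (openGraph ω).Adj x y} ≤ f s(x, y) + g s(x, y) := by
  by_cases hxy : s(x, y).IsDiag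
  · simp [openGraph_adj, hxy]
  · simp only [openGraph_adj, hxy, not_false_eq_true, exists_true_left]
    exact (sumTraceLaw_open_le ⟨s(x, y), hxy⟩).trans (add_le_add (hP _) (hQ _))

lemma ae_atMostOneInfiniteCluster_of_null [Countable V] {ν : Measure (Bond V → Bool)}
    (hν : ∀ x y, ν {ω | (openGraph ω).Adj x y} = 0) : ∀ᵐ ω ∂ν, AtMostOneInfiniteCluster ω := by
  have hadj : ∀ᵐ ω ∂ν, ∀ x y, ¬ (openGraph ω).Adj x y :=
    ae_all_iff.2 fun x => ae_all_iff.2 fun y => by simpa [ae_iff] using hν x y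
  filter_upwards [hadj] with ω hω
  have hbot : openGraph ω = ⊥ := SimpleGraph.eq_bot_iff_forall_not_adj.2 hω
  refine atMostOneInfiniteCluster_iff.2 fun x hx => (hx.infinite 0) ?_
  simp [hbot, SimpleGraph.reachable_bot]

end SumTrace

/-! ### Infinite-volume limits along boxes -/

section Limits

lemma currentWeight_succ_le {V : Type*} {K : Sym2 V → ℝ} {e : Bond V} (hK : 0 ≤ K e.1) (m : ℕ) :
    currentWeight K {e} (fun _ => m + 1) ≤ K e.1 * (K e.1 ^ m / (m ! : ℝ)) := by
  simp only [currentWeight, Finset.prod_singleton, pow_succ', mul_div_assoc]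
  gcongr
  exact Nat.le_succ m

lemma measure_ne_zero_le {V : Type*} {K : Sym2 V → ℝ} {P : Measure (Current V)} {e : Bond V}
    (hK : 0 ≤ K e.1)
    (hP : ∀ m, P (pointCylinder {e} fun _ => m) ≤ ENNReal.ofReal (currentWeight K {e} fun _ => m)) :
    P {n | n e ≠ 0} ≤ ENNReal.ofReal (K e.1 * Real.exp (K e.1)) := by
  have hsub : {n : Current V | n e ≠ 0} ⊆ ⋃ m : ℕ, pointCylinder {e} fun _ => m + 1 := by
    intro n hn
    obtain ⟨m, hm⟩ := Nat.exists_eq_succ_of_ne_zero hn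
    exact Set.mem_iUnion.2 ⟨m, by simpa [pointCylinder] using hm⟩
  have hsum : Summable fun m : ℕ => K e.1 * (K e.1 ^ m / (m ! : ℝ)) :=
    (Real.summable_pow_div_factorial _).mul_left _
  calc P {n | n e ≠ 0} ≤ ∑' m : ℕ, P (pointCylinder {e} fun _ => m + 1) :=
        (measure_mono hsub).trans (measure_iUnion_le _)
    _ ≤ ∑' m : ℕ, ENNReal.ofReal (K e.1 * (K e.1 ^ m / (m ! : ℝ))) :=
        ENNReal.tsum_le_tsum fun m =>
          (hP (m + 1)).trans (ENNReal.ofReal_le_ofReal (currentWeight_succ_le hK m))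
    _ = ENNReal.ofReal (K e.1 * Real.exp (K e.1)) := by
        rw [← ENNReal.ofReal_tsum_of_nonneg (fun m => by positivity) hsum, tsum_mul_left,
          Real.exp_eq_exp_ℝ, NormedSpace.exp_eq_tsum_div]

lemma IsInfiniteVolumeLimit.measure_ne_zero_le {V : Type*} {K : Sym2 V → ℝ} (hK : ∀ e, 0 ≤ K e)
    {μ : ℕ → Measure (Current V)} {P : Measure (Current V)} (hP : IsInfiniteVolumeLimit μ P)
    (hle : ∀ L e m, μ L (pointCylinder {e} fun _ => m) ≤
      ENNReal.ofReal (currentWeight K {e} fun _ => m)) (e : Bond V) :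
    P {n | n e ≠ 0} ≤ ENNReal.ofReal (K e.1 * Real.exp (K e.1)) :=
  _root_.measure_ne_zero_le (hK _) fun m =>
    le_of_tendsto (hP.tendsto_pointCylinder _ _) (Eventually.of_forall fun L => hle L e m)

lemma tsum_ofReal_mul_exp_ne_top {ι : Type*} {f : ι → ℝ} (hf : ∀ i, 0 ≤ f i) (hs : Summable f) :
    ∑' i, ENNReal.ofReal (f i * Real.exp (f i)) ≠ ∞ := by
  have hle (i : ι) : f i * Real.exp (f i) ≤ f i * Real.exp (∑' j, f j) :=
    mul_le_mul_of_nonneg_left (Real.exp_le_exp.2 (hs.le_tsum i fun _ _ => hf _)) (hf i)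
  exact (Summable.of_nonneg_of_le (fun i => mul_nonneg (hf i) (Real.exp_nonneg _)) hle
    (hs.mul_right _)).tsum_ofReal_ne_top

variable {d : ℕ} {J : Sym2 (Fin d → ℤ) → ℝ} {β : ℝ}

theorem exists_infiniteVolumeLimit_freeCurrentLaw (hJ : ∀ e, 0 ≤ β * J e) :
    ∃ P, IsInfiniteVolumeLimit (fun L => freeCurrentLaw J β (latticeBox d L)) P :=
  exists_infiniteVolumeLimit (fun _ => isProbabilityMeasure_finiteCurrentLaw hJ _ _)
    (tsum_currentWeight_singleton_ne_top (β • J)) (fun _ => finiteCurrentLaw_singleton_le hJ _ _)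
    fun E k => (exists_tendsto_freeCurrentLaw hJ E k).imp fun _ hl => hl.comp (tendsto_latticeBox d)

theorem exists_infiniteVolumeLimit_plusCurrentLaw (hβ : 0 ≤ β) (hJ : ∀ e, 0 ≤ J e)
    (hJs : ∀ x, Summable fun y => J s(x, y)) :
    ∃ P, IsInfiniteVolumeLimit (fun L => plusCurrentLaw J β (latticeBox d L)) P :=
  exists_infiniteVolumeLimit (fun _ => isProbabilityMeasure_plusCurrentLaw hβ hJ _)
    (tsum_currentWeight_singleton_ne_top (β • J)) (fun _ => plusCurrentLaw_singleton_le hβ hJ _)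
    fun E k => (exists_tendsto_plusCurrentLaw hβ hJ hJs E k).imp
      fun _ hl => hl.comp (tendsto_latticeBox d)

variable {P Q : Measure (Current (Fin d → ℤ))}

lemma sumTraceLaw_adj_le_of_limits (hβ : 0 ≤ β) (hJ : ∀ e, 0 ≤ J e)
    (hP : IsInfiniteVolumeLimit (fun L => freeCurrentLaw J β (latticeBox d L)) P)
    (hQ : IsInfiniteVolumeLimit (fun L => plusCurrentLaw J β (latticeBox d L)) Q)
    (x y : Fin d → ℤ) : sumTraceLaw P Q {ω | (openGraph ω).Adj x y} ≤
      2 * ENNReal.ofReal (β * J s(x, y) * Real.exp (β * J s(x, y))) := by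
  have hβJ (e) : 0 ≤ β * J e := mul_nonneg hβ (hJ e)
  have := hP.isProbabilityMeasure
  have := hQ.isProbabilityMeasure
  let q (e : Sym2 (Fin d → ℤ)) : ℝ≥0∞ := ENNReal.ofReal (β * J e * Real.exp (β * J e))
  rw [two_mul]
  exact sumTraceLaw_adj_le (f := q) (g := q)
    (hP.measure_ne_zero_le hβJ fun _ => finiteCurrentLaw_singleton_le hβJ _ _)
    (hQ.measure_ne_zero_le hβJ fun _ => plusCurrentLaw_singleton_le hβ hJ _) x y

lemma sumTraceLaw_map_comp_congr_of_limits (hβ : 0 ≤ β) (hJ : ∀ e, 0 ≤ J e)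
    (hJs : ∀ x, Summable fun y => J s(x, y))
    (hP : IsInfiniteVolumeLimit (fun L => freeCurrentLaw J β (latticeBox d L)) P)
    (hQ : IsInfiniteVolumeLimit (fun L => plusCurrentLaw J β (latticeBox d L)) Q)
    {θ : (Fin d → ℤ) ≃ (Fin d → ℤ)} (hθ : ∀ e, J (e.map θ) = J e) :
    (sumTraceLaw P Q).map (fun ω => ω ∘ Bond.congr θ) = sumTraceLaw P Q := by
  have := hP.isProbabilityMeasure
  have := hQ.isProbabilityMeasure
  refine sumTraceLaw_map_comp_congr ?_ ?_
  · exact map_comp_congr_of_tendsto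
      (hP.tendsto_net (exists_tendsto_freeCurrentLaw fun e => mul_nonneg hβ (hJ e)))
      (freeCurrentLaw_map β hθ)
  · exact map_comp_congr_of_tendsto (hQ.tendsto_net (exists_tendsto_plusCurrentLaw hβ hJ hJs))
      (plusCurrentLaw_map β hθ)

end Limits

/-! ### Translation-invariant couplings -/

section Couplings

variable {V : Type*} {J : Sym2 V → ℝ}

/-- The graph of the pairs with a positive coupling. -/
def couplingGraph (J : Sym2 V → ℝ) : SimpleGraph V :=
  SimpleGraph.fromEdgeSet {e | 0 < J e}

lemma pos_of_mem_edgeSet_couplingGraph {e : Sym2 V} (he : e ∈ (couplingGraph J).edgeSet) :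
    0 < J e := by
  rw [couplingGraph, SimpleGraph.edgeSet_fromEdgeSet] at he
  exact he.1

lemma reachable_couplingGraph_of_pos {x y : V} (h : 0 < J s(x, y)) :
    (couplingGraph J).Reachable x y := by
  rcases eq_or_ne x y with rfl | hxy
  · rfl
  · exact SimpleGraph.Adj.reachable ((SimpleGraph.fromEdgeSet_adj _).2 ⟨h, hxy⟩)

variable [AddGroup V]

lemma map_addRight_of_forall_sub (hJ : ∀ x y, J s(x, y) = J s(0, y - x)) (a : V) (e : Sym2 V) :
    J (e.map (Equiv.addRight a)) = J e := by
  induction e using Sym2.ind with | _ x y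
  rw [Sym2.map_mk, hJ, hJ x y]
  simp

lemma summable_of_forall_sub (hJ : ∀ x y, J s(x, y) = J s(0, y - x))
    (hs : Summable fun x => J s(0, x)) (x : V) : Summable fun y => J s(x, y) := by
  simp only [hJ x]
  exact (Equiv.subRight x).summable_iff.2 hs

lemma preconnected_couplingGraph (hJ : ∀ x y, J s(x, y) = J s(0, y - x)) (hJ₀ : ∀ e, 0 ≤ J e)
    (hpath : ∀ x, ∃ (m : ℕ) (p : ℕ → V), p 0 = 0 ∧ p m = x ∧
      0 < ∏ i ∈ Finset.range m, J s(p i, p (i + 1))) :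
    (couplingGraph J).Preconnected := by
  intro x y
  obtain ⟨m, p, h₀, hm, hp⟩ := hpath (y - x)
  have hpos (i : ℕ) (hi : i < m) : 0 < J s(p i + x, p (i + 1) + x) :=
    ((hJ₀ _).lt_of_ne' (Finset.prod_ne_zero_iff.1 hp.ne' i (Finset.mem_range.2 hi))).trans_eq
      (map_addRight_of_forall_sub hJ x s(p i, p (i + 1))).symm
  have hreach (i : ℕ) (hi : i ≤ m) : (couplingGraph J).Reachable x (p i + x) := by
    induction i with
    | zero => simp [h₀]
    | succ i ih => exact (ih (by omega)).trans (reachable_couplingGraph_of_pos (hpos i hi))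
  simpa [hm] using hreach m le_rfl

end Couplings

theorem theorem2p3 (d : ℕ) (J : Sym2 (Fin d → ℤ) → ℝ)
    (C1 : ∀ x y, J s(x, y) = J s(0, y - x))
    (C2 : ∀ x y, 0 ≤ J s(x, y))
    (C3 : Summable fun x => J s(0, x))
    (C4 : ∀ x, ∃ (m : ℕ) (p : ℕ → Fin d → ℤ), p 0 = 0 ∧ p m = x ∧
      0 < ∏ i ∈ Finset.range m, J s(p i, p (i + 1)))
    (β : ℝ) (hβ : 0 ≤ β) :
    (∃ P, IsInfiniteVolumeLimit (fun L => freeCurrentLaw J β (latticeBox d L)) P) ∧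
    (∃ P, IsInfiniteVolumeLimit (fun L => plusCurrentLaw J β (latticeBox d L)) P) ∧
    ∀ Pfree Pplus : Measure (Current (Fin d → ℤ)),
      IsInfiniteVolumeLimit (fun L => freeCurrentLaw J β (latticeBox d L)) Pfree →
      IsInfiniteVolumeLimit (fun L => plusCurrentLaw J β (latticeBox d L)) Pplus →
      ∀ᵐ ω ∂(sumTraceLaw Pfree Pplus), AtMostOneInfiniteCluster ω := by
  have hJ (e) : 0 ≤ J e := Sym2.ind C2 e
  have hβJ (e) : 0 ≤ β * J e := mul_nonneg hβ (hJ e)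
  have hJs := summable_of_forall_sub C1 C3
  refine ⟨exists_infiniteVolumeLimit_freeCurrentLaw hβJ,
    exists_infiniteVolumeLimit_plusCurrentLaw hβ hJ hJs, fun P Q hP hQ => ?_⟩
  have := hP.isProbabilityMeasure
  have := hQ.isProbabilityMeasure
  have := isProbabilityMeasure_sumTraceLaw (P := P) (Q := Q)
  have hadj := sumTraceLaw_adj_le_of_limits hβ hJ hP hQ
  rcases hβ.eq_or_lt with rfl | hβ₀
  · exact ae_atMostOneInfiniteCluster_of_null fun x y => by simpa using hadj x y
  have hq := tsum_ofReal_mul_exp_ne_top (fun x => hβJ s(0, x)) (C3.mul_left β)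
  refine ae_atMostOneInfiniteCluster
    (fun a => sumTraceLaw_map_comp_congr_of_limits hβ hJ hJs hP hQ
      (map_addRight_of_forall_sub C1 a))
    (ENNReal.tsum_mul_left.trans_ne (ENNReal.mul_ne_top ENNReal.ofNat_ne_top hq))
    (fun x y => C1 x y ▸ hadj x y) (preconnected_couplingGraph C1 hJ C4) fun e he => ?_
  exact sumTraceLaw_map_openBonds_absolutelyContinuous <| map_add_two_absolutelyContinuous hβJ
    (hP.tendsto_net (exists_tendsto_freeCurrentLaw hβJ))
    (mul_pos hβ₀ (pos_of_mem_edgeSet_couplingGraph he))
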